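/- Let $k$ be an algebraically closed field of characteristic $0$. A graded nilpotent Lie algebra (GNLA) is a finite-dimensional Lie algebra $\mathfrak m=\bigoplus_{i=1}^{s}\mathfrak m_{-i}$ over $k$, graded by negative integers and generated by $\mathfrak m_{-1}$. It is non-degenerate if $\mathfrak m_{-1}$ contains no non-zero central element of $\mathfrak m$. Let $\mathfrak n$ be a (possibly degenerate) GNLA, $W\subset\mathfrak n_{-1}$ a subspace, and $V=\bigoplus_{i=1}^{\mu}V_{-i}$ a graded $\mathfrak n$-module, generated by $V_{-1}$ as a module, with $W.V=0$ and $\mathfrak n_{-i}.V=0$ for all $i\ge 2$. A special extension of $\mathfrak n$ by means of $V$ is a graded Lie algebra $\mathfrak m$ with an exact sequence $0\to V\to\mathfrak m\to\mathfrak n\to 0$ of degree-preserving maps, in which $V$ is a commutative ideal of $\mathfrak m$, $\mathfrak m\to\mathfrak n$ is a Lie algebra homomorphism, and the action of $\mathfrak n=\mathfrak m/V$ on $V$ induced by the bracket of $\mathfrak m$ is the given one. The Tanaka prolongation of $\mathfrak m$ is $\mathfrak g(\mathfrak m)=\mathfrak m\oplus\bigoplus_{j\ge 0}\mathfrak g_j$,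 where, with $\mathfrak g_i=\mathfrak m_i$ for $i<0$, the space $\mathfrak g_j$ is defined inductively as the space of all linear maps $\varphi\colon\mathfrak m\to\bigoplus_{i<j}\mathfrak g_i$ with $\varphi(\mathfrak m_{-i})\subset\mathfrak g_{j-i}$ for all $i\ge 1$ and $\varphi([x,y])=[\varphi(x),y]+[x,\varphi(y)]$ for all $x,y\in\mathfrak m$; here $[\psi,x]=-[x,\psi]=\psi(x)$ for $\psi\in\mathfrak g_i$, $i\ge 0$, $x\in\mathfrak m$. Theorem. Let $\mathfrak m$ be a non-degenerate GNLA over $k$. The following conditions are equivalent: 1. there exists a degree-preserving derivation $d$ of $\mathfrak m$ such that $d(\mathfrak m_{-i})=0$ for all $i\ge 2$ and $\operatorname{rank} d=1$; 2. there exists $y\in\mathfrak m_{-1}$ such that $\operatorname{rank}\operatorname{ad} y=1$; 3. $\mathfrak m$ is a special extension of some (possibly degenerate) GNLA $\mathfrak n$ by means of some $V=\bigoplus_{i=1}^{\mu}V_{-i}$ such that $\dim\mathfrak m_{-1}=\dim\mathfrak n_{-1}+1$, $\mu\ge 2$, and $\dim V_{-i}=1$ for all $i=1,\dots,\mu$;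 4. $\mathfrak g(\mathfrak m)$ is infinite-dimensional. Moreover, every $y\in\mathfrak m_{-1}$ with $\operatorname{rank}\operatorname{ad} y=1$ satisfies $[y,\mathfrak m_{-i}]=0$ for all $i\ge 2$. -/

import Mathlib

universe u v

namespace GNLA

/-- A finite-dimensional Lie algebra `L = ⨁_{i ≥ 1} ℒ (-i)`, graded by negative integers and
generated by its component of degree `-1`. By finite dimension only finitely many
components are non-zero, so `L` is nilpotent. -/
structure IsGNLA {K : Type u} {L : Type v} [Field K] [LieRing L] [LieAlgebra K L]
    (ℒ : ℤ → Submodule K L) : Prop where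
  finiteDimensional : FiniteDimensional K L
  isInternal : DirectSum.IsInternal ℒ
  gradedBracket : SetLike.GradedBracket ℒ
  eq_bot_of_nonneg : ∀ i : ℤ, 0 ≤ i → ℒ i = ⊥
  generated : LieSubalgebra.lieSpan K L (ℒ (-1) : Set L) = ⊤

/-- The component of degree `-1` contains no non-zero central element. -/
def IsNonDegenerate {K : Type u} {L : Type v} [Field K] [LieRing L] [LieAlgebra K L]
    (ℒ : ℤ → Submodule K L) : Prop :=
  ∀ y ∈ ℒ (-1), y ∈ LieAlgebra.center K L → y = 0

/-- A presentation of the graded Lie algebra `(L, ℒ)` as a special extension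
`0 → V → L → N → 0` of a (possibly degenerate) GNLA `N` by means of an `N`-module `V`. -/
structure SpecialExtension {K : Type u} {L : Type v} [Field K] [LieRing L] [LieAlgebra K L]
    (ℒ : ℤ → Submodule K L) where
  /-- The GNLA that is extended. -/
  N : Type v
  [lieRingN : LieRing N]
  [lieAlgebraN : LieAlgebra K N]
  /-- The grading of `N`. -/
  gradN : ℤ → Submodule K N
  isGNLA : IsGNLA gradN
  /-- The subspace of `N_{-1}` that acts trivially on the module. -/
  W : Submodule K N
  W_le : W ≤ gradN (-1)
  /-- The module by means of which `N` is extended. -/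
  V : Type v
  [addCommGroupV : AddCommGroup V]
  [moduleV : Module K V]
  [lieRingModuleV : LieRingModule N V]
  [lieModuleV : LieModule K N V]
  /-- The grading of `V`. -/
  gradV : ℤ → Submodule K V
  isInternal_V : DirectSum.IsInternal gradV
  /-- The module is `V = ⨁_{i = 1}^{μ} V_{-i}`. -/
  μ : ℕ
  gradV_eq_bot : ∀ i : ℤ, 0 ≤ i ∨ i < -(μ : ℤ) → gradV i = ⊥
  lie_mem : ∀ i j : ℤ, ∀ x ∈ gradN i, ∀ v ∈ gradV j, ⁅x, v⁆ ∈ gradV (i + j)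
  /-- The action of `N` factors through `N → N_{-1} / W`. -/
  lie_W : ∀ x ∈ W, ∀ v : V, ⁅x, v⁆ = 0
  lie_of_le_neg_two : ∀ i : ℤ, i ≤ -2 → ∀ x ∈ gradN i, ∀ v : V, ⁅x, v⁆ = 0
  /-- `V` is generated by `V_{-1}` as a module. -/
  generated_V : LieSubmodule.lieSpan K N (gradV (-1) : Set V) = ⊤
  /-- The inclusion of `V`. -/
  incl : V →ₗ[K] L
  /-- The projection onto `N`. -/
  proj : L →ₗ⁅K⁆ N
  incl_injective : Function.Injective incl
  exact : Function.Exact incl proj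
  proj_surjective : Function.Surjective proj
  /-- The image of `V` is commutative. -/
  incl_lie_incl : ∀ v w : V, ⁅incl v, incl w⁆ = 0
  /-- The adjoint action on the ideal `V` is the given `N`-module structure. -/
  lie_incl : ∀ (x : L) (v : V), ⁅x, incl v⁆ = incl ⁅proj x, v⁆
  incl_mem : ∀ i : ℤ, ∀ v ∈ gradV i, incl v ∈ ℒ i
  proj_mem : ∀ i : ℤ, ∀ x ∈ ℒ i, proj x ∈ gradN i

/-- A vector space with subspaces indexed by degree and with brackets against `L`. It carries
the sum of the components of degree less than `k` of the Tanaka prolongation. -/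
structure Truncation (K : Type u) (L : Type v) [Field K] [LieRing L] [LieAlgebra K L] where
  /-- The underlying vector space. -/
  carrier : Type v
  [addCommGroup : AddCommGroup carrier]
  [module : Module K carrier]
  /-- The component of each degree. -/
  comp : ℤ → Submodule K carrier
  /-- `br p x` is the bracket `[p, x]` of `p` with `x ∈ L`. -/
  br : carrier →ₗ[K] L →ₗ[K] carrier

attribute [instance] Truncation.addCommGroup Truncation.module

/-- The space of linear maps `φ : L → P` of degree `k` such that
`φ [x, y] = [φ x, y] + [x, φ y]`, where `[x, φ y] = -[φ y, x]`. -/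
def Truncation.next {K : Type u} {L : Type v} [Field K] [LieRing L] [LieAlgebra K L]
    (ℒ : ℤ → Submodule K L) (P : Truncation K L) (k : ℤ) :
    Submodule K (L →ₗ[K] P.carrier) where
  carrier := {φ | (∀ i : ℤ, ∀ x ∈ ℒ i, φ x ∈ P.comp (k + i)) ∧
    ∀ x y : L, φ ⁅x, y⁆ = P.br (φ x) y - P.br (φ y) x}
  zero_mem' := by simp
  add_mem' := by
    rintro φ ψ ⟨h1, h2⟩ ⟨h3, h4⟩
    refine ⟨fun i x hx => (P.comp _).add_mem (h1 i x hx) (h3 i x hx), fun x y => ?_⟩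
    simp only [LinearMap.add_apply, map_add, h2 x y, h4 x y]
    abel
  smul_mem' := by
    rintro c φ ⟨h1, h2⟩
    refine ⟨fun i x hx => (P.comp _).smul_mem c (h1 i x hx), fun x y => ?_⟩
    simp only [LinearMap.smul_apply, map_smul, h2 x y, smul_sub]

/-- Adjoin to `P` the space `P.next ℒ k` in degree `k`, with the bracket `[φ, x] = φ x`. -/
def Truncation.extend {K : Type u} {L : Type v} [Field K] [LieRing L] [LieAlgebra K L]
    (ℒ : ℤ → Submodule K L) (P : Truncation K L) (k : ℤ) : Truncation K L where
  carrier := P.carrier × P.next ℒ k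
  comp := fun j => (P.comp j).prod (if j = k then ⊤ else ⊥)
  br := (P.br.coprod (P.next ℒ k).subtype).compr₂ (LinearMap.inl K P.carrier (P.next ℒ k))

/-- `truncation ℒ k` is `⨁_{i < k} g_i`: it starts with `L` itself for `k = 0`, and `g_k` is
adjoined in step `k`. -/
def truncation {K : Type u} {L : Type v} [Field K] [LieRing L] [LieAlgebra K L]
    (ℒ : ℤ → Submodule K L) : ℕ → Truncation K L
  | 0 => { carrier := L, comp := ℒ, br := (LieAlgebra.ad K L : L →ₗ[K] Module.End K L) }
  | k + 1 => (truncation ℒ k).extend ℒ k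

/-- The component `g_k`, `k ≥ 0`, of the Tanaka prolongation: all linear maps
`φ : L → ⨁_{i < k} g_i` with `φ L_{-i} ⊆ g_{k - i}` and `φ [x, y] = [φ x, y] + [x, φ y]`. -/
abbrev tanakaComponent {K : Type u} {L : Type v} [Field K] [LieRing L] [LieAlgebra K L]
    (ℒ : ℤ → Submodule K L) (k : ℕ) :
    Submodule K (L →ₗ[K] (truncation ℒ k).carrier) :=
  (truncation ℒ k).next ℒ k

/-- The underlying vector space `L ⊕ ⨁_{k ≥ 0} g_k` of the Tanaka prolongation. -/
abbrev TanakaProlongation {K : Type u} {L : Type v} [Field K] [LieRing L] [LieAlgebra K L]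
    (ℒ : ℤ → Submodule K L) : Type v :=
  L × DirectSum ℕ (fun k => tanakaComponent ℒ k)

/-- The Tanaka prolongation is infinite-dimensional. -/
def IsInfiniteType {K : Type u} {L : Type v} [Field K] [LieRing L] [LieAlgebra K L]
    (ℒ : ℤ → Submodule K L) : Prop :=
  ¬ FiniteDimensional K (TanakaProlongation ℒ)

end GNLA

/-!
Elements of rank one and derivations of rank one carry the same data: a vector `y` of degree `-1`
and a functional `a` that vanishes in degrees at most `-2`, such that `[y, x] = a x • w`
(`IsRankOneData`). The derivation is `x ↦ a x • y`. If `ad y` has rank one, its image lies in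
degree `-2`, for otherwise `y` would be central, so `ad y` vanishes in degrees at most `-2`.

*Special extensions.* Let `a x₀ = 1`. The ideal generated by `y` is spanned by the iterated
brackets of `y` with `x₀`, and every `z` acts on it as `a z • ad x₀`; the quotient by this ideal
is the required algebra. Conversely, `V_{-1}` is spanned by an element whose adjoint map has its
image in the line `V_{-2}`.

*Infinite prolongations, from rank one.* If `p` of degree `k - 1` in the prolongation satisfies
`[p, z] = a z • q`, then `z ↦ a z • p` is an element of degree `k` of the same form. Starting with
`y`, no component of the prolongation vanishes.

*Infinite prolongations, to rank one.* Let `B_j` be the subspace of the prolongation that commutes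
with the components of degree at most `-j`, so that `B_1` is bounded in degree. The component of
degree `-j` acts on `B_{j + 1}` by commuting operators with common kernel `B_j`. If `B_j` is
bounded in degree, then, dually, the graded dual `D` of `B_{j + 1}` is finitely generated over
these operators (`IsGradedBy.eq_top_of_lowPart_le`). If it is infinite-dimensional, Hilbert's
Nullstellensatz provides a nonzero point `c` in its support
(`exists_ne_zero_iSup_range_sub_ne_top`).

For `j ≥ 2` this is absurd: the component of degree `-j` consists of sums of commutators of
operators commuting with it, and on the finite-dimensional fibre of `D` at `c` the trace of a
commutator is zero, whereas it should be a nonzero scalar times the dimension. Hence an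
infinite-dimensional prolongation forces `B_2` to be infinite-dimensional, and for `j = 1` a
functional on the fibre at `c` is a formal sum `∑ φ_k` of elements `φ_k` of degree `k` in `B_2`
such that `[φ_k, x] = c x • φ_{k - 1}` for `x` of degree `-1`. All `φ_k` with `k ≥ -1` are nonzero,
and `φ_0` is a derivation of rank one with values in the line through `φ_{-1}`.
-/

namespace GNLA

/-! ### Elements and derivations of rank one -/

section Basic

/-- The maps of rank one are the maps `x ↦ a x • w` with `a ≠ 0` and `w ≠ 0`. -/
theorem rank_eq_one_iff {K M N : Type*} [Field K] [AddCommGroup M] [Module K M]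
    [AddCommGroup N] [Module K N] (f : M →ₗ[K] N) :
    LinearMap.rank f = 1 ↔
      ∃ (a : Module.Dual K M) (w : N), a ≠ 0 ∧ w ≠ 0 ∧ ∀ x, f x = a x • w := by
  constructor
  · intro h
    obtain ⟨w, hw, hspan⟩ := _root_.rank_eq_one_iff.1 h
    have hw' : (w : N) ≠ 0 := fun h => hw (Subtype.ext h)
    have hmem : ∀ x, f x ∈ Submodule.span K {(w : N)} := fun x => by
      obtain ⟨r, hr⟩ := hspan ⟨f x, x, rfl⟩
      exact Submodule.mem_span_singleton.2 ⟨r, congrArg Subtype.val hr⟩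
    let e := LinearEquiv.toSpanNonzeroSingleton K N (w : N) hw'
    let a : Module.Dual K M := e.symm.toLinearMap ∘ₗ f.codRestrict _ hmem
    have ha : ∀ x, f x = a x • (w : N) := fun x => by
      have := congrArg Subtype.val (e.apply_symm_apply ⟨f x, hmem x⟩)
      exact this.symm
    refine ⟨a, w, ?_, hw', ha⟩
    rintro h0
    obtain ⟨x, hx⟩ := w.2
    rw [ha, h0] at hx
    exact hw' (by simpa using hx.symm)
  · rintro ⟨a, w, ha, hw, h⟩
    obtain ⟨x, hx⟩ : ∃ x, a x ≠ 0 := by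
      by_contra! h0
      exact ha (LinearMap.ext h0)
    refine _root_.rank_eq_one_iff.2 ⟨⟨f x, x, rfl⟩, ?_, ?_⟩
    · intro h0
      exact smul_ne_zero hx hw ((h x).symm.trans (congrArg Subtype.val h0))
    · rintro ⟨_, y, rfl⟩
      refine ⟨a y * (a x)⁻¹, Subtype.ext ?_⟩
      simp [h, smul_smul, hx]

theorem rank_eq_one_of_forall_mem_span {K M N : Type*} [Field K] [AddCommGroup M] [Module K M]
    [AddCommGroup N] [Module K N] {f : M →ₗ[K] N} (w : N)
    (h : ∀ x, f x ∈ Submodule.span K {w}) (hf : f ≠ 0) : LinearMap.rank f = 1 := by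
  refine le_antisymm ?_ ?_
  · have hle : LinearMap.range f ≤ Submodule.span K {w} := by
      rintro _ ⟨x, rfl⟩
      exact h x
    exact (Submodule.rank_mono hle).trans (rank_span_le _ |>.trans (by simp))
  · rw [Cardinal.one_le_iff_ne_zero]
    exact fun h0 => hf (LinearMap.range_eq_bot.1 (Submodule.rank_eq_zero.1 h0))

variable {K : Type u} {L : Type v} [Field K] [LieRing L] [LieAlgebra K L]
  {ℒ : ℤ → Submodule K L}

theorem IsGNLA.lie_mem (h : IsGNLA ℒ) {i j : ℤ} {x y : L} (hx : x ∈ ℒ i) (hy : y ∈ ℒ j) :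
    ⁅x, y⁆ ∈ ℒ (i + j) :=
  h.gradedBracket.bracket_mem hx hy

theorem IsGNLA.eq_zero_of_mem_of_mem (h : IsGNLA ℒ) {i j : ℤ} (hij : i ≠ j) {x : L}
    (hi : x ∈ ℒ i) (hj : x ∈ ℒ j) : x = 0 :=
  Submodule.disjoint_def.1 (h.isInternal.submodule_iSupIndep.pairwiseDisjoint hij) x hi hj

/-- A subspace that contains all components of negative degree is everything. -/
theorem IsGNLA.eq_top_of_forall_le (h : IsGNLA ℒ) (P : Submodule K L)
    (hP : ∀ i, i < 0 → ℒ i ≤ P) : P = ⊤ := by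
  rw [eq_top_iff, ← h.isInternal.submodule_iSup_eq_top]
  refine iSup_le fun i => ?_
  rcases lt_or_ge i 0 with hi | hi
  · exact hP i hi
  · rw [h.eq_bot_of_nonneg i hi]
    exact bot_le

theorem IsGNLA.exists_mem_ne_zero (h : IsGNLA ℒ) {M : Type*} [AddCommGroup M] [Module K M]
    {f : L →ₗ[K] M} (hf : f ≠ 0) : ∃ i, i < 0 ∧ ∃ x ∈ ℒ i, f x ≠ 0 := by
  by_contra! h0
  refine hf (LinearMap.ker_eq_top.1 (h.eq_top_of_forall_le _ fun i hi x hx => h0 i hi x hx))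

/-- Elements commuting with the component of degree `-1` are central, as it generates. -/
theorem IsGNLA.mem_center (h : IsGNLA ℒ) {y : L} (hy : ∀ x ∈ ℒ (-1), ⁅x, y⁆ = 0) :
    y ∈ LieAlgebra.center K L := by
  let C : LieSubalgebra K L :=
    { LinearMap.ker ((LieAlgebra.ad K L y : L →ₗ[K] L)) with
      lie_mem' := by
        intro a b ha hb
        have ha' : ⁅y, a⁆ = 0 := ha
        have hb' : ⁅y, b⁆ = 0 := hb
        change ⁅y, ⁅a, b⁆⁆ = 0
        rw [leibniz_lie, ha', hb']
        simp }
  have hC : C = ⊤ := by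
    rw [eq_top_iff, ← h.generated, LieSubalgebra.lieSpan_le]
    intro x hx
    change ⁅y, x⁆ = 0
    rw [← lie_skew, hy x hx, neg_zero]
  rw [LieModule.mem_maxTrivSubmodule]
  intro x
  have hx : x ∈ C := hC ▸ trivial
  have : ⁅y, x⁆ = 0 := hx
  rw [← lie_skew, this, neg_zero]

theorem IsNonDegenerate.eq_zero (hnd : IsNonDegenerate ℒ) (h : IsGNLA ℒ) {y : L}
    (hy1 : y ∈ ℒ (-1)) (hy : ∀ x ∈ ℒ (-1), ⁅x, y⁆ = 0) : y = 0 :=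
  hnd y hy1 (h.mem_center hy)

/-- The component of degree `-(n + 2)` is spanned by the brackets of elements of degrees `-1`
and `-(n + 1)`. -/
theorem IsGNLA.span_lie_eq (h : IsGNLA ℒ) (n : ℕ) :
    Submodule.span K {z | ∃ x ∈ ℒ (-1), ∃ y ∈ ℒ (-(n + 1 : ℤ)), ⁅x, y⁆ = z} =
      ℒ (-(n + 2 : ℤ)) := by
  -- `G n` is spanned by the iterated brackets of `n + 1` elements of degree `-1`; the sum of the
  -- `G n` is a subalgebra, hence everything.
  obtain ⟨G, hG0, hGsucc⟩ : ∃ G : ℕ → Submodule K L, G 0 = ℒ (-1) ∧ ∀ n, G (n + 1) =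
      Submodule.span K {z | ∃ x ∈ ℒ (-1), ∃ y ∈ G n, ⁅x, y⁆ = z} :=
    ⟨fun n => Nat.rec (ℒ (-1))
      (fun _ P => Submodule.span K {z | ∃ x ∈ ℒ (-1), ∃ y ∈ P, ⁅x, y⁆ = z}) n, rfl, fun _ => rfl⟩
  have hGle : ∀ n : ℕ, G n ≤ ℒ (-(n + 1 : ℤ)) := by
    intro n
    induction n with
    | zero => exact le_of_eq (by simp [hG0])
    | succ n ih =>
      rw [hGsucc, Submodule.span_le]
      rintro _ ⟨x, hx, y, hy, rfl⟩
      have hdeg : (-((n + 1 : ℕ) + 1 : ℤ)) = -1 + -(n + 1 : ℤ) := by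
        push_cast
        ring
      rw [hdeg]
      exact h.lie_mem hx (ih hy)
  have hGlie : ∀ m n : ℕ, ∀ x ∈ G m, ∀ y ∈ G n, ⁅x, y⁆ ∈ G (m + n + 1) := by
    intro m
    induction m with
    | zero =>
      intro n x hx y hy
      rw [zero_add, hGsucc]
      rw [hG0] at hx
      exact Submodule.subset_span ⟨x, hx, y, hy, rfl⟩
    | succ m ih =>
      intro n x hx y hy
      rw [hGsucc] at hx
      induction hx using Submodule.span_induction with
      | mem z hz =>
        obtain ⟨a, ha, b, hb, rfl⟩ := hz
        rw [lie_lie]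
        refine Submodule.sub_mem _ ?_ ?_
        · have h1 := ih n b hb y hy
          have : G (m + 1 + n + 1) = G ((m + n + 1) + 1) := by congr 1; omega
          rw [this, hGsucc]
          exact Submodule.subset_span ⟨a, ha, _, h1, rfl⟩
        · have h1 : ⁅a, y⁆ ∈ G (n + 1) := by
            rw [hGsucc]
            exact Submodule.subset_span ⟨a, ha, y, hy, rfl⟩
          have h2 := ih (n + 1) b hb _ h1
          have : G (m + 1 + n + 1) = G (m + (n + 1) + 1) := by congr 1; omega
          rwa [this]
      | zero => simp
      | add a b _ _ ha hb =>
        rw [add_lie]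
        exact Submodule.add_mem _ ha hb
      | smul c a _ ha =>
        rw [smul_lie]
        exact Submodule.smul_mem _ _ ha
  have hGtop : (⨆ n, G n) = ⊤ := by
    let S : LieSubalgebra K L :=
      { (⨆ n, G n) with
        lie_mem' := by
          intro x y hx hy
          change x ∈ ⨆ n, G n at hx
          change y ∈ ⨆ n, G n at hy
          change ⁅x, y⁆ ∈ ⨆ n, G n
          induction hx using Submodule.iSup_induction' with
          | mem m x hx =>
            induction hy using Submodule.iSup_induction' with
            | mem n y hy => exact Submodule.mem_iSup_of_mem _ (hGlie m n x hx y hy)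
            | zero => simp
            | add a b _ _ ha hb =>
              rw [lie_add]
              exact Submodule.add_mem _ ha hb
          | zero => simp
          | add a b _ _ ha hb =>
            rw [add_lie]
            exact Submodule.add_mem _ ha hb }
    have hS : S = ⊤ := by
      rw [eq_top_iff, ← h.generated, LieSubalgebra.lieSpan_le]
      intro x hx
      exact Submodule.mem_iSup_of_mem 0 (hG0 ▸ hx)
    exact congrArg LieSubalgebra.toSubmodule hS
  have hGeq : ∀ n : ℕ, G n = ℒ (-(n + 1 : ℤ)) := by
    intro n
    refine le_antisymm (hGle n) fun x hx => ?_
    have hx' : x ∈ G n ⊔ ⨆ (k : ℤ) (_ : k ≠ -(n + 1 : ℤ)), ℒ k := by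
      have hle : (⨆ m, G m) ≤ G n ⊔ ⨆ (k : ℤ) (_ : k ≠ -(n + 1 : ℤ)), ℒ k := by
        refine iSup_le fun m => ?_
        by_cases hmn : m = n
        · exact hmn ▸ le_sup_left
        · refine le_trans ((hGle m).trans ?_) le_sup_right
          exact le_iSup₂_of_le (-(m + 1 : ℤ)) (by omega) le_rfl
      exact hle (hGtop ▸ trivial)
    obtain ⟨g, hg, r, hr, rfl⟩ := Submodule.mem_sup.1 hx'
    have hr' : r ∈ ℒ (-(n + 1 : ℤ)) := by
      simpa using Submodule.sub_mem _ hx (hGle n hg)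
    have hr0 : r = 0 := Submodule.disjoint_def.1
      (h.isInternal.submodule_iSupIndep (-(n + 1 : ℤ))) r hr' hr
    rw [hr0, add_zero]
    exact hg
  have h1 := hGeq (n + 1)
  rw [hGsucc, hGeq n] at h1
  rw [h1]
  congr 1

/-- A functional that vanishes in degrees at most `-2` vanishes on all brackets. -/
theorem IsGNLA.apply_lie_eq_zero (h : IsGNLA ℒ) {a : Module.Dual K L}
    (ha : ∀ i, i ≤ -2 → ∀ x ∈ ℒ i, a x = 0) (x z : L) : a ⁅x, z⁆ = 0 := by
  let P : Submodule K L := LinearMap.ker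
    ((LieModule.toEnd K L L : L →ₗ[K] Module.End K L).compr₂ a)
  have hP : P = ⊤ := by
    refine h.eq_top_of_forall_le _ fun i hi x hx => ?_
    refine LinearMap.mem_ker.2 (LinearMap.ker_eq_top.1 ?_)
    refine h.eq_top_of_forall_le _ fun j hj z hz => ?_
    exact ha (i + j) (by omega) _ (h.lie_mem hx hz)
  have hx : x ∈ P := hP ▸ trivial
  exact LinearMap.congr_fun (LinearMap.mem_ker.1 hx) z

/-- The data common to all conditions: `[y, x] = a x • w` for a nonzero functional `a` that
vanishes in degrees at most `-2`. -/
structure IsRankOneData (ℒ : ℤ → Submodule K L) (y : L) (a : Module.Dual K L) (w : L) :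
    Prop where
  y_mem : y ∈ ℒ (-1)
  y_ne : y ≠ 0
  a_ne : a ≠ 0
  a_eq : ∀ i, i ≤ -2 → ∀ x ∈ ℒ i, a x = 0
  lie_eq : ∀ x, ⁅y, x⁆ = a x • w

theorem IsRankOneData.exists_eq_one (hL : IsGNLA ℒ) {y : L} {a : Module.Dual K L} {w : L}
    (h : IsRankOneData ℒ y a w) : ∃ x ∈ ℒ (-1), a x = 1 := by
  obtain ⟨i, hi, x, hx, hax⟩ := hL.exists_mem_ne_zero h.a_ne
  have hi1 : i = -1 := by
    by_contra hne
    exact hax (h.a_eq i (by omega) x hx)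
  subst hi1
  exact ⟨(a x)⁻¹ • x, Submodule.smul_mem _ _ hx, by simp [hax]⟩

theorem IsRankOneData.w_ne (hL : IsGNLA ℒ) (hnd : IsNonDegenerate ℒ) {y : L}
    {a : Module.Dual K L} {w : L} (h : IsRankOneData ℒ y a w) : w ≠ 0 := by
  rintro rfl
  refine h.y_ne (hnd.eq_zero hL h.y_mem fun x _ => ?_)
  rw [← lie_skew, h.lie_eq]
  simp

theorem IsRankOneData.a_lie (hL : IsGNLA ℒ) {y : L} {a : Module.Dual K L} {w : L}
    (h : IsRankOneData ℒ y a w) (x z : L) : a ⁅x, z⁆ = 0 :=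
  hL.apply_lie_eq_zero h.a_eq x z

/-- If `ad y` has rank one, its image lies in degree `-2`, since otherwise `y` would be
central; hence `ad y` vanishes in degrees at most `-2`. -/
theorem exists_isRankOneData_of_rank_ad (hL : IsGNLA ℒ) (hnd : IsNonDegenerate ℒ) {y : L}
    (hy : y ∈ ℒ (-1)) (hr : LinearMap.rank (LieAlgebra.ad K L y) = 1) :
    ∃ a w, IsRankOneData ℒ y a w := by
  obtain ⟨a, w, ha, hw, h⟩ := (rank_eq_one_iff _).1 hr
  have h' : ∀ x, ⁅y, x⁆ = a x • w := h
  have hy0 : y ≠ 0 := by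
    rintro rfl
    refine ha (LinearMap.ext fun x => ?_)
    have := h' x
    rw [zero_lie] at this
    exact (smul_eq_zero.1 this.symm).resolve_right hw
  obtain ⟨x, hx, hax⟩ : ∃ x ∈ ℒ (-1), a x ≠ 0 := by
    by_contra! h0
    refine hy0 (hnd.eq_zero hL hy fun x hx => ?_)
    rw [← lie_skew, h', h0 x hx]
    simp
  have hw2 : w ∈ ℒ (-2) := by
    have h1 := hL.lie_mem hy hx
    rw [h'] at h1
    exact ((ℒ (-2)).smul_mem_iff hax).1 h1
  refine ⟨a, w, hy, hy0, ha, fun i hi z hz => ?_, h'⟩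
  have h1 := hL.lie_mem hy hz
  rw [h'] at h1
  have h2 := hL.eq_zero_of_mem_of_mem (by omega) h1 (Submodule.smul_mem _ (a z) hw2)
  exact (smul_eq_zero.1 h2).resolve_right hw

theorem IsRankOneData.rank_ad (hL : IsGNLA ℒ) (hnd : IsNonDegenerate ℒ) {y : L}
    {a : Module.Dual K L} {w : L} (h : IsRankOneData ℒ y a w) :
    LinearMap.rank (LieAlgebra.ad K L y) = 1 :=
  (rank_eq_one_iff _).2 ⟨a, w, h.a_ne, h.w_ne hL hnd, h.lie_eq⟩

theorem IsRankOneData.exists_lieDerivation (hL : IsGNLA ℒ) {y : L}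
    {a : Module.Dual K L} {w : L} (h : IsRankOneData ℒ y a w) :
    ∃ d : LieDerivation K L L,
        (∀ i : ℤ, ∀ x ∈ ℒ i, d x ∈ ℒ i) ∧
        (∀ i : ℤ, i ≤ -2 → ∀ x ∈ ℒ i, d x = 0) ∧
        LinearMap.rank (d : L →ₗ[K] L) = 1 := by
  let d : LieDerivation K L L :=
    { a.smulRight y with
      leibniz' := fun x z => by
        change a ⁅x, z⁆ • y = ⁅x, a z • y⁆ - ⁅z, a x • y⁆
        rw [h.a_lie hL, lie_smul, lie_smul, ← lie_skew, ← lie_skew z, h.lie_eq, h.lie_eq,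
          smul_neg, smul_neg, smul_smul, smul_smul, mul_comm (a x)]
        simp }
  have hd : ∀ x, d x = a x • y := fun _ => rfl
  refine ⟨d, fun i x hx => ?_, fun i hi x hx => ?_, (rank_eq_one_iff _).2
    ⟨a, y, h.a_ne, h.y_ne, hd⟩⟩
  · rw [hd]
    rcases lt_trichotomy i (-1) with hi | rfl | hi
    · rw [h.a_eq i (by omega) x hx, zero_smul]
      exact Submodule.zero_mem _
    · exact Submodule.smul_mem _ _ h.y_mem
    · rw [hL.eq_bot_of_nonneg i (by omega), Submodule.mem_bot] at hx
      simp [hx]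
  · rw [hd, h.a_eq i hi x hx, zero_smul]

/-- If `x ↦ a x • y` is a derivation, then `a x • [y, z]` is symmetric in `x` and `z`. -/
theorem exists_isRankOneData_of_lieDerivation (hL : IsGNLA ℒ) (d : LieDerivation K L L)
    (hd0 : ∀ i : ℤ, ∀ x ∈ ℒ i, d x ∈ ℒ i) (hd2 : ∀ i : ℤ, i ≤ -2 → ∀ x ∈ ℒ i, d x = 0)
    (hr : LinearMap.rank (d : L →ₗ[K] L) = 1) : ∃ y a w, IsRankOneData ℒ y a w := by
  obtain ⟨a, y, ha, hy, h⟩ := (rank_eq_one_iff _).1 hr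
  have h' : ∀ x, d x = a x • y := h
  have ha2 : ∀ i : ℤ, i ≤ -2 → ∀ x ∈ ℒ i, a x = 0 := fun i hi x hx => by
    have := hd2 i hi x hx
    rw [h'] at this
    exact (smul_eq_zero.1 this).resolve_right hy
  obtain ⟨i, hi, x, hx, hax⟩ := hL.exists_mem_ne_zero ha
  have hi1 : i = -1 := by
    by_contra hne
    exact hax (ha2 i (by omega) x hx)
  subst hi1
  have hy1 : y ∈ ℒ (-1) := by
    have h1 := hd0 _ x hx
    rw [h'] at h1
    exact ((ℒ (-1)).smul_mem_iff hax).1 h1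
  refine ⟨y, a, (a x)⁻¹ • ⁅y, x⁆, hy1, hy, ha, ha2, fun z => ?_⟩
  have h1 := d.apply_lie_eq_sub x z
  rw [h', h', h', hL.apply_lie_eq_zero ha2, zero_smul, lie_smul, lie_smul, ← lie_skew,
    ← lie_skew z, smul_neg, smul_neg, eq_comm, sub_neg_eq_add, neg_add_eq_zero] at h1
  rw [smul_smul, mul_comm, ← smul_smul, h1, smul_smul, inv_mul_cancel₀ hax, one_smul]

/-- The kernel of a special extension with one-dimensional components is spanned in degree `-1`
by a vector `y` with `[y, L] ⊆ V_{-2}`. -/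
theorem SpecialExtension.exists_rank_ad (hL : IsGNLA ℒ) (hnd : IsNonDegenerate ℒ)
    (E : SpecialExtension ℒ) (hμ : 2 ≤ E.μ)
    (hdim : ∀ i : ℕ, 1 ≤ i → i ≤ E.μ → Module.finrank K (E.gradV (-(i : ℤ))) = 1) :
    ∃ y ∈ ℒ (-1), LinearMap.rank (LieAlgebra.ad K L y) = 1 := by
  let := E.lieRingN
  let := E.lieAlgebraN
  let := E.addCommGroupV
  let := E.moduleV
  let := E.lieRingModuleV
  have := E.lieModuleV
  obtain ⟨⟨v, hv⟩, hv0, -⟩ := finrank_eq_one_iff'.1 (hdim 1 le_rfl (by omega))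
  obtain ⟨⟨w, hw⟩, hw0, hw2⟩ := finrank_eq_one_iff'.1 (hdim 2 (by omega) hμ)
  have hv0' : v ≠ 0 := fun h => hv0 (Subtype.ext h)
  have hy : E.incl v ∈ ℒ (-1) := E.incl_mem _ v hv
  have hspan : ∀ x, ⁅E.incl v, x⁆ ∈ Submodule.span K {E.incl w} := by
    intro x
    let P : Submodule K L := (Submodule.span K {E.incl w}).comap
      (LieAlgebra.ad K L (E.incl v) : L →ₗ[K] L)
    have hP : P = ⊤ := by
      refine hL.eq_top_of_forall_le _ fun i hi x hx => ?_
      change ⁅E.incl v, x⁆ ∈ Submodule.span K {E.incl w}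
      rw [← lie_skew, E.lie_incl]
      refine Submodule.neg_mem _ ?_
      rcases eq_or_ne i (-1) with rfl | hne
      · obtain ⟨c, hc⟩ := hw2 ⟨_, E.lie_mem _ _ _ (E.proj_mem _ x hx) v hv⟩
        have hc' : c • w = ⁅E.proj x, v⁆ := congrArg Subtype.val hc
        rw [← hc', map_smul]
        exact Submodule.smul_mem _ _ (Submodule.mem_span_singleton_self _)
      · rw [E.lie_of_le_neg_two i (by omega) _ (E.proj_mem _ x hx) v, map_zero]
        exact Submodule.zero_mem _
    have hx : x ∈ P := hP ▸ trivial
    exact hx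
  refine ⟨E.incl v, hy, rank_eq_one_of_forall_mem_span (E.incl w) hspan fun h0 => ?_⟩
  refine hv0' (E.incl_injective ?_)
  rw [map_zero]
  refine hnd.eq_zero hL hy fun x _ => ?_
  rw [← lie_skew, neg_eq_zero]
  exact LinearMap.congr_fun h0 x

end Basic

/-! ### Elements of rank one give an infinite-dimensional prolongation -/

section RankOneInfinite

variable {K : Type u} {L : Type v} [Field K] [LieRing L] [LieAlgebra K L]
  {ℒ : ℤ → Submodule K L}

theorem Truncation.extend_br (P : Truncation K L) (k : ℤ) (p : P.carrier) (φ : P.next ℒ k)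
    (x : L) : (P.extend ℒ k).br ((p, φ) : P.carrier × P.next ℒ k) x =
      ((P.br p x + (φ : L →ₗ[K] P.carrier) x, 0) : P.carrier × P.next ℒ k) := rfl

theorem IsRankOneData.smulRight_mem (hL : IsGNLA ℒ) {y : L} {a : Module.Dual K L} {w : L}
    (h : IsRankOneData ℒ y a w) {k : ℕ} {p q : (truncation ℒ k).carrier}
    (hp : p ∈ (truncation ℒ k).comp (k - 1)) (hq : ∀ z, (truncation ℒ k).br p z = a z • q) :
    a.smulRight p ∈ tanakaComponent ℒ k := by
  refine ⟨fun i x hx => ?_, fun x z => ?_⟩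
  · rw [LinearMap.smulRight_apply]
    rcases lt_trichotomy i (-1) with hi | rfl | hi
    · rw [h.a_eq i (by omega) x hx, zero_smul]
      exact Submodule.zero_mem _
    · exact Submodule.smul_mem _ _ hp
    · rw [hL.eq_bot_of_nonneg i (by omega), Submodule.mem_bot] at hx
      simp [hx]
  · simp [h.a_lie hL, hq, smul_smul, mul_comm]

theorem IsRankOneData.smulRight_ne_zero (hL : IsGNLA ℒ) {y : L} {a : Module.Dual K L} {w : L}
    (h : IsRankOneData ℒ y a w) {k : ℕ} {p : (truncation ℒ k).carrier} (hp : p ≠ 0)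
    (hd : a.smulRight p ∈ tanakaComponent ℒ k) :
    (⟨a.smulRight p, hd⟩ : tanakaComponent ℒ k) ≠ 0 := by
  obtain ⟨x, -, hx⟩ := h.exists_eq_one hL
  intro h0
  have := LinearMap.congr_fun (congrArg Subtype.val h0) x
  exact hp (by simpa [hx] using this)

/-- A vector `p` of degree `k - 1` in the prolongation with `[p, z] = a z • q` gives the element
`z ↦ a z • p` of degree `k`, whose brackets have the same form. -/
theorem IsRankOneData.exists_truncation (hL : IsGNLA ℒ) {y : L} {a : Module.Dual K L} {w : L}
    (h : IsRankOneData ℒ y a w) (k : ℕ) :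
    ∃ p : (truncation ℒ k).carrier, p ≠ 0 ∧ p ∈ (truncation ℒ k).comp (k - 1) ∧
      (∃ q, ∀ z, (truncation ℒ k).br p z = a z • q) := by
  induction k with
  | zero =>
    refine ⟨y, h.y_ne, ?_, w, h.lie_eq⟩
    change y ∈ ℒ (((0 : ℕ) : ℤ) - 1)
    simpa using h.y_mem
  | succ k ih =>
    obtain ⟨p, hp0, hpmem, q, hq⟩ := ih
    refine ⟨((0, ⟨a.smulRight p, h.smulRight_mem hL hpmem hq⟩) :
        (truncation ℒ k).carrier × tanakaComponent ℒ k),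
      fun h0 => h.smulRight_ne_zero hL hp0 (h.smulRight_mem hL hpmem hq) (congrArg Prod.snd h0),
      ⟨Submodule.zero_mem _, ?_⟩,
      ((p, 0) : (truncation ℒ k).carrier × tanakaComponent ℒ k), fun z => ?_⟩
    · simp
    · refine (Truncation.extend_br _ _ _ _ _).trans ?_
      refine Prod.ext ?_ (smul_zero _).symm
      change (truncation ℒ k).br 0 z + a z • p = a z • p
      simp

theorem IsRankOneData.nontrivial_tanakaComponent (hL : IsGNLA ℒ) {y : L} {a : Module.Dual K L}
    {w : L} (h : IsRankOneData ℒ y a w) (k : ℕ) : Nontrivial (tanakaComponent ℒ k) := by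
  obtain ⟨p, hp0, hpmem, q, hq⟩ := h.exists_truncation hL k
  exact ⟨⟨_, h.smulRight_mem hL hpmem hq⟩, 0, h.smulRight_ne_zero hL hp0 _⟩

end RankOneInfinite

/-! ### Finitely generated modules over commuting endomorphisms -/

open scoped IsMulCommutative in
/-- For commuting endomorphisms `x i` of `D`, an infinite-dimensional module that is finitely
generated over them has a nonzero point in its support: this is Hilbert's Nullstellensatz
combined with Nakayama's lemma. -/
theorem exists_ne_zero_iSup_range_sub_ne_top {K D : Type*} [Field K] [IsAlgClosed K]
    [AddCommGroup D] [Module K D] {ι : Type*} [Finite ι] (x : ι → Module.End K D)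
    (hx : ∀ i j, Commute (x i) (x j)) (F : Submodule K D) (hF : F.FG)
    (hgen : ∀ P : Submodule K D, F ≤ P → (∀ i, ∀ d ∈ P, x i d ∈ P) → P = ⊤)
    (hD : ¬ FiniteDimensional K D) :
    ∃ c : ι → K, c ≠ 0 ∧ (⨆ i, LinearMap.range (x i - c i • 1)) ≠ ⊤ := by
  classical
  have hcomm : ∀ a ∈ Set.range x, ∀ b ∈ Set.range x, a * b = b * a := by
    rintro _ ⟨i, rfl⟩ _ ⟨j, rfl⟩
    exact hx i j
  let S := Algebra.adjoin K (Set.range x)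
  have : IsMulCommutative S := Algebra.isMulCommutative_adjoin K hcomm
  let y : ι → S := fun i => ⟨x i, Algebra.subset_adjoin ⟨i, rfl⟩⟩
  have hFT : Algebra.FiniteType K S :=
    (Subalgebra.fg_iff_finiteType S).1 ⟨(Set.finite_range x).toFinset, by simp [S]⟩
  have hJ : IsJacobsonRing S := isJacobsonRing_of_finiteType (A := K)
  have hsmul : ∀ (s : S) (d : D), s • d = (s : Module.End K D) d := fun _ _ => rfl
  have : IsScalarTower K S D := ⟨fun a s d => by simp [hsmul]⟩
  obtain ⟨s, hs⟩ := hF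
  have hfg : (⊤ : Submodule S D).FG := by
    refine ⟨s, ?_⟩
    have := hgen ((Submodule.span S (s : Set D)).restrictScalars K) ?_ ?_
    · simpa using this
    · rw [← hs, Submodule.span_le]
      exact Submodule.subset_span
    · intro i d hd
      exact Submodule.smul_mem _ (y i) hd
  have hfin : Module.Finite S D := ⟨hfg⟩
  -- Otherwise the `y i` lie in all maximal ideals of the Jacobson ring `S`, so they are nilpotent,
  -- and `S` and `D` are finite-dimensional.
  obtain ⟨M, hM, i₀, hi₀⟩ : ∃ M : Ideal S, M.IsMaximal ∧ ∃ i, y i ∉ M := by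
    by_contra! hcon
    refine hD ?_
    have hnil : ∀ i, IsNilpotent (y i) := by
      intro i
      rw [← mem_nilradical, nilradical, Ideal.radical_eq_jacobson, Ideal.jacobson,
        Submodule.mem_sInf]
      exact fun M hM => hcon M hM.2 i
    have : Module.Finite K S := by
      have hxint : ∀ i, IsIntegral K (y i) := by
        intro i
        obtain ⟨n, hn⟩ := hnil i
        exact ⟨Polynomial.X ^ n, Polynomial.monic_X_pow n, by simpa using hn⟩
      have h1 : Algebra.adjoin K (Set.range y) = ⊤ := by
        have h2 : Set.range y = (Subtype.val) ⁻¹' (Set.range x) := by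
          ext z
          constructor
          · rintro ⟨i, rfl⟩
            exact ⟨i, rfl⟩
          · rintro ⟨i, hi⟩
            exact ⟨i, Subtype.ext hi⟩
        rw [h2]
        exact Algebra.adjoin_adjoin_coe_preimage
      have h3 := fg_adjoin_of_finite (R := K) (Set.finite_range y) (by
        rintro _ ⟨i, rfl⟩
        exact hxint i)
      rw [h1] at h3
      exact ⟨by simpa using h3⟩
    exact Module.Finite.trans (R := K) S D
  have hMbij : Function.Bijective (algebraMap K (S ⧸ M)) := by
    let := Ideal.Quotient.field M
    have : Module.Finite K (S ⧸ M) := finite_of_finite_type_of_isJacobsonRing K (S ⧸ M)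
    have : Algebra.IsIntegral K (S ⧸ M) := Algebra.IsIntegral.of_finite K (S ⧸ M)
    exact IsAlgClosed.algebraMap_bijective_of_isIntegral
  choose c hc using fun i => hMbij.2 (Ideal.Quotient.mk M (y i))
  have hcM : ∀ i, y i - algebraMap K S (c i) ∈ M :=
    fun i => Ideal.Quotient.eq.1 (hc i).symm
  refine ⟨c, ?_, ?_⟩
  · rintro rfl
    exact hi₀ (by simpa using hcM i₀)
  · intro htop
    have hle : (⊤ : Submodule S D) ≤ M • ⊤ := by
      have h4 : (⨆ i, LinearMap.range (x i - c i • 1)) ≤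
          (M • (⊤ : Submodule S D)).restrictScalars K := by
        refine iSup_le fun i => ?_
        rintro _ ⟨d, rfl⟩
        have h5 : (y i - algebraMap K S (c i)) • d ∈ M • (⊤ : Submodule S D) :=
          Submodule.smul_mem_smul (hcM i) trivial
        have h6 : (y i - algebraMap K S (c i)) • d = (x i - c i • 1) d := by
          rw [sub_smul, algebraMap_smul]
          rfl
        rw [h6] at h5
        exact h5
      intro d _
      exact h4 (htop ▸ trivial)
    -- Nakayama's lemma: `M D = D` gives `r ∈ 1 + M` killing `D`, and `S` acts faithfully on `D`.
    obtain ⟨r, hr1, hr2⟩ :=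
      Submodule.exists_sub_one_mem_and_smul_eq_zero_of_fg_of_le_smul M ⊤ hfg hle
    have hr0 : r = 0 := Subtype.ext (LinearMap.ext fun d => hr2 d trivial)
    refine hM.ne_top ((Ideal.eq_top_iff_one M).2 ?_)
    rw [hr0, zero_sub] at hr1
    exact (neg_mem_iff (H := M)).1 hr1

/-- If the generating operators are commutators of operators commuting with all of them, then the
fibre at a point `c` of the support has a nonzero finite dimension, and `c i` times this dimension
is the trace of a commutator. So `c = 0`, and `D` is finite-dimensional. -/
theorem finiteDimensional_of_commutators {K D : Type*} [Field K] [IsAlgClosed K] [CharZero K]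
    [AddCommGroup D] [Module K D] {ι : Type*} [Finite ι] (x a b : ι → Module.End K D)
    (hab : ∀ i, x i = a i * b i - b i * a i)
    (ha : ∀ i j, Commute (a i) (x j)) (hb : ∀ i j, Commute (b i) (x j))
    (F : Submodule K D) (hF : F.FG)
    (hgen : ∀ P : Submodule K D, F ≤ P → (∀ i, ∀ d ∈ P, x i d ∈ P) → P = ⊤) :
    FiniteDimensional K D := by
  by_contra hD
  have hx : ∀ i j, Commute (x i) (x j) := fun i j => by
    rw [hab i]
    exact ((ha i j).mul_left (hb i j)).sub_left ((hb i j).mul_left (ha i j))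
  obtain ⟨c, hc, hR⟩ := exists_ne_zero_iSup_range_sub_ne_top x hx F hF hgen hD
  set R := ⨆ i, LinearMap.range (x i - c i • 1) with hRdef
  have hxR : ∀ i d, x i d - c i • d ∈ R := fun i d =>
    Submodule.mem_iSup_of_mem i ⟨d, by simp⟩
  have hstab : ∀ f : Module.End K D, (∀ j, Commute f (x j)) → R ≤ R.comap f := by
    intro f hf
    rw [hRdef]
    refine iSup_le fun j => ?_
    rintro _ ⟨d, rfl⟩
    have h : f (x j d) = x j (f d) := LinearMap.congr_fun (hf j) d
    simpa [h] using hxR j (f d)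
  have htop : F ⊔ R = ⊤ := by
    refine hgen _ le_sup_left fun i d hd => ?_
    have h := (F ⊔ R).add_mem (Submodule.mem_sup_right (hxR i d)) ((F ⊔ R).smul_mem (c i) hd)
    simpa using h
  have hfin : FiniteDimensional K (D ⧸ R) := by
    refine ⟨?_⟩
    have : F.map R.mkQ = ⊤ := by
      have h1 : (F ⊔ R).map R.mkQ = ⊤ := by rw [htop]; simp
      simpa [Submodule.map_sup] using h1
    rw [← this]
    exact hF.map _
  obtain ⟨i, hi⟩ := Function.ne_iff.1 hc
  have hnt : Nontrivial (D ⧸ R) := Submodule.Quotient.nontrivial_iff.2 hR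
  set A := R.mapQ R (a i) (hstab _ (ha i))
  set B := R.mapQ R (b i) (hstab _ (hb i))
  have hAB : A * B - B * A = c i • (1 : Module.End K (D ⧸ R)) := by
    ext d
    have h1 : (a i (b i d) - b i (a i d)) - c i • d ∈ R := by
      have := hxR i d
      rw [hab i] at this
      simpa using this
    have h2 := (Submodule.Quotient.mk_eq_zero R).2 h1
    rw [Submodule.Quotient.mk_sub, sub_eq_zero] at h2
    simpa [A, B] using h2
  have htr := congrArg (LinearMap.trace K (D ⧸ R)) hAB
  rw [map_sub, LinearMap.trace_mul_comm, sub_self, map_smul, LinearMap.trace_one] at htr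
  have hpos : (0 : ℕ) < Module.finrank K (D ⧸ R) := Module.finrank_pos
  rcases smul_eq_zero.1 htr.symm with h | h
  · exact hi h
  · exact hpos.ne' (by exact_mod_cast h)

/-! ### Graded duals -/

section GradedDual

variable {K B : Type*} [Field K] [AddCommGroup B] [Module K B]

/-- The projections of `B` onto the components of a `ℤ`-grading by finite-dimensional subspaces
that vanish in degrees below `s`. Unlike a direct sum decomposition, this passes to graded
subspaces by mere restriction. -/
structure IsGradedBy (π : ℤ → Module.End K B) (s : ℤ) : Prop where
  finite_range : ∀ k, FiniteDimensional K (LinearMap.range (π k))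
  proj_self : ∀ k b, π k (π k b) = π k b
  proj_of_ne : ∀ k l, k ≠ l → ∀ b, π k (π l b) = 0
  sum_proj : ∀ b, ∃ n, ∑ k ∈ Finset.Ico s n, π k b = b

/-- `y` maps the component of degree `k` to that of degree `k + i`. -/
def HasDegree (π : ℤ → Module.End K B) (y : Module.End K B) (i : ℤ) : Prop :=
  ∀ k b, π (k + i) (y b) = y (π k b)

/-- The space of functionals that vanish on the components of large degree. -/
def gradedDualSubmodule (π : ℤ → Module.End K B) : Submodule K (Module.Dual K B) where
  carrier := {f | ∃ N, ∀ k, N ≤ k → ∀ b, f (π k b) = 0}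
  zero_mem' := ⟨0, by simp⟩
  add_mem' := by
    rintro f g ⟨M, hM⟩ ⟨N, hN⟩
    exact ⟨max M N, fun k hk b => by
      simp [hM k (le_of_max_le_left hk) b, hN k (le_of_max_le_right hk) b]⟩
  smul_mem' := by
    rintro c f ⟨M, hM⟩
    exact ⟨M, fun k hk b => by simp [hM k hk b]⟩

/-- The graded dual of `B`, made a type of its own so that instance search does not unfold it to
a submodule of a space of linear maps. -/
def GradedDual (π : ℤ → Module.End K B) : Type _ := gradedDualSubmodule π

variable {π : ℤ → Module.End K B} {s : ℤ}

namespace GradedDual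

instance : AddCommGroup (GradedDual π) := Submodule.addCommGroup (gradedDualSubmodule π)

instance : Module K (GradedDual π) := (gradedDualSubmodule π).module

/-- An element of the graded dual as a functional. -/
def ev : GradedDual π →ₗ[K] Module.Dual K B := (gradedDualSubmodule π).subtype

theorem ext {f g : GradedDual π} (h : ∀ b, ev f b = ev g b) : f = g :=
  Subtype.ext (LinearMap.ext h)

theorem exists_ev_proj_eq_zero (f : GradedDual π) : ∃ N, ∀ k, N ≤ k → ∀ b, ev f (π k b) = 0 :=
  f.2

end GradedDual

open GradedDual

/-- The functional `g` on the component of degree `k`, extended by zero. -/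
def IsGradedBy.single (hπ : IsGradedBy π s) (k : ℤ) : Module.Dual K B →ₗ[K] GradedDual π :=
  LinearMap.codRestrict (gradedDualSubmodule π) (Module.Dual.transpose (R := K) (π k)) fun g =>
    ⟨k + 1, fun l hl b => by
      simp [Module.Dual.transpose_apply, hπ.proj_of_ne k l (by omega) b]⟩

@[simp]
theorem IsGradedBy.ev_single (hπ : IsGradedBy π s) (k : ℤ) (g : Module.Dual K B) (b : B) :
    ev (hπ.single k g) b = g (π k b) := rfl

/-- The transpose of a homogeneous endomorphism, acting on the graded dual. -/
def HasDegree.transpose {y : Module.End K B} {i : ℤ} (hy : HasDegree π y i) :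
    Module.End K (GradedDual π) :=
  LinearMap.restrict (p := gradedDualSubmodule π) (q := gradedDualSubmodule π)
    (Module.Dual.transpose (R := K) y) (by
      rintro f ⟨N, hN⟩
      refine ⟨N - i, fun k hk b => ?_⟩
      rw [Module.Dual.transpose_apply, LinearMap.comp_apply, ← hy k b]
      exact hN _ (by omega) _)

@[simp]
theorem HasDegree.ev_transpose {y : Module.End K B} {i : ℤ} (hy : HasDegree π y i)
    (f : GradedDual π) (b : B) : ev (hy.transpose f) b = ev f (y b) := rfl

theorem HasDegree.commute_transpose {y z : Module.End K B} {i j : ℤ} (hy : HasDegree π y i)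
    (hz : HasDegree π z j) (h : Commute y z) : Commute hy.transpose hz.transpose := by
  refine LinearMap.ext fun f => GradedDual.ext fun b => ?_
  have hb : y (z b) = z (y b) := LinearMap.congr_fun h b
  simp [hb]

theorem IsGradedBy.proj_eq_zero (hπ : IsGradedBy π s) (b : B) :
    ∃ n, ∀ k, n ≤ k → π k b = 0 := by
  obtain ⟨n, hn⟩ := hπ.sum_proj b
  refine ⟨n, fun k hk => ?_⟩
  rw [← hn, map_sum]
  refine Finset.sum_eq_zero fun l hl => hπ.proj_of_ne k l ?_ b
  rw [Finset.mem_Ico] at hl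
  omega

theorem IsGradedBy.ext_proj (hπ : IsGradedBy π s) {M : Type*} [AddCommGroup M] [Module K M]
    {f g : B →ₗ[K] M} (h : ∀ k, s ≤ k → ∀ b, f (π k b) = g (π k b)) : f = g := by
  ext b
  obtain ⟨n, hn⟩ := hπ.sum_proj b
  rw [← hn, map_sum, map_sum]
  exact Finset.sum_congr rfl fun k hk => h k (Finset.mem_Ico.1 hk).1 b

/-- A graded space is finite-dimensional as soon as its components of large degree vanish. -/
theorem IsGradedBy.finiteDimensional (hπ : IsGradedBy π s) (N : ℤ)
    (hN : ∀ k, N ≤ k → ∀ b, π k b = 0) : FiniteDimensional K B := by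
  have hfin := hπ.finite_range
  refine FiniteDimensional.of_injective
    (LinearMap.pi fun k : Finset.Ico s N => (π k).rangeRestrict)
    ((injective_iff_map_eq_zero _).2 fun b hb => ?_)
  obtain ⟨n, hn⟩ := hπ.sum_proj b
  rw [← hn]
  refine Finset.sum_eq_zero fun k hk => ?_
  by_cases hkN : N ≤ k
  · exact hN k hkN b
  · have hk' : k ∈ Finset.Ico s N := by
      rw [Finset.mem_Ico] at hk ⊢
      omega
    simpa using congrArg Subtype.val (congrFun hb ⟨k, hk'⟩)

theorem IsGradedBy.exists_forall_proj_eq_zero (hπ : IsGradedBy π s) [FiniteDimensional K B] :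
    ∃ N, ∀ k, N ≤ k → ∀ b, π k b = 0 := by
  choose n hn using hπ.proj_eq_zero
  obtain ⟨t, ht⟩ := (Module.finite_def (R := K) (M := B)).1 inferInstance
  obtain ⟨N, hN⟩ := (t.image n).bddAbove
  refine ⟨N, fun k hk b => ?_⟩
  have : (⊤ : Submodule K B) ≤ LinearMap.ker (π k) := by
    rw [← ht, Submodule.span_le]
    exact fun b hb => hn b k (le_trans (hN (Finset.mem_image_of_mem n hb)) hk)
  exact this trivial

theorem IsGradedBy.finiteDimensional_of_gradedDual (hπ : IsGradedBy π s)
    [FiniteDimensional K (GradedDual π)] : FiniteDimensional K B := by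
  refine FiniteDimensional.of_injective
    (ev (π := π)).flip
    ((injective_iff_map_eq_zero _).2 fun b hb => ?_)
  obtain ⟨n, hn⟩ := hπ.sum_proj b
  rw [← hn]
  refine Finset.sum_eq_zero fun k _ => ?_
  rw [← Module.forall_dual_apply_eq_zero_iff K]
  exact fun g => LinearMap.congr_fun hb (hπ.single k g)

/-- The functionals that vanish in degrees at least `N` form a finite-dimensional space. -/
theorem IsGradedBy.fg_lowPart (hπ : IsGradedBy π s) (N : ℤ) :
    ∃ F : Submodule K (GradedDual π), F.FG ∧
      ∀ f, f ∈ F ↔ ∀ k, N ≤ k → ∀ b, ev f (π k b) = 0 := by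
  let F : Submodule K (GradedDual π) :=
    { carrier := {f | ∀ k, N ≤ k → ∀ b, ev f (π k b) = 0}
      zero_mem' := by simp
      add_mem' := fun {f g} hf hg k hk b => by
        simp [hf k hk b, hg k hk b]
      smul_mem' := fun c f hf k hk b => by simp [hf k hk b] }
  refine ⟨F, ?_, fun f => Iff.rfl⟩
  have hfin := hπ.finite_range
  let e : GradedDual π →ₗ[K] (k : Finset.Ico s N) → Module.Dual K (LinearMap.range (π k)) :=
    LinearMap.pi fun k =>
      (Module.Dual.transpose (R := K) (LinearMap.range (π k)).subtype) ∘ₗ ev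
  have : FiniteDimensional K F := by
    refine FiniteDimensional.of_injective (e ∘ₗ F.subtype)
      ((injective_iff_map_eq_zero _).2 fun f hf => ?_)
    refine Subtype.ext (GradedDual.ext (LinearMap.congr_fun (hπ.ext_proj fun k hk b => ?_)))
    by_cases hkN : N ≤ k
    · simpa using f.2 k hkN b
    · have h := LinearMap.congr_fun (congrFun hf ⟨k, by rw [Finset.mem_Ico]; omega⟩) ⟨π k b, b, rfl⟩
      exact h
  exact Module.Finite.iff_fg.1 this

/-- Dual form of the graded Nakayama lemma: if the operators `x i` have no common kernel in
degrees at least `N`, their transposes generate the graded dual from its part below `N`. -/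
theorem IsGradedBy.eq_top_of_lowPart_le (hπ : IsGradedBy π s) {ι : Type*} [Fintype ι]
    {x : ι → Module.End K B} {j : ℤ} (hj : 0 < j) (hx : ∀ i, HasDegree π (x i) (-j)) (N : ℤ)
    (hker : ∀ k, N ≤ k → ∀ b, π k b = b → (∀ i, x i b = 0) → b = 0)
    (P : Submodule K (GradedDual π))
    (hP : ∀ f : GradedDual π, (∀ k, N ≤ k → ∀ b, ev f (π k b) = 0) → f ∈ P)
    (hPx : ∀ i, ∀ f ∈ P, (hx i).transpose f ∈ P) : P = ⊤ := by
  classical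
  have key : ∀ n : ℕ, ∀ f : GradedDual π,
      (∀ k, N + n ≤ k → ∀ b, ev f (π k b) = 0) → f ∈ P := by
    intro n
    induction n with
    | zero => exact fun f hf => hP f fun k hk => hf k (by simpa using hk)
    | succ n ih =>
      intro f hf
      set M : ℤ := N + n
      let Ψ : LinearMap.range (π M) →ₗ[K] ι → B :=
        LinearMap.pi fun i => x i ∘ₗ (LinearMap.range (π M)).subtype
      have hΨ : LinearMap.ker Ψ = ⊥ := by
        refine LinearMap.ker_eq_bot'.2 ?_
        rintro ⟨_, b, rfl⟩ hb
        exact Subtype.ext (hker M (by omega) _ (hπ.proj_self M b) fun i => congrFun hb i)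
      -- Functionals in degree `M` factor through the injective map `b ↦ (x i b)`.
      obtain ⟨r, hr⟩ := LinearMap.exists_leftInverse_of_injective Ψ hΨ
      let G : Module.Dual K (ι → B) :=
        ev f ∘ₗ (LinearMap.range (π M)).subtype ∘ₗ r
      have hG : ∀ b, G (fun i => x i (π M b)) = ev f (π M b) := fun b => by
        have h := LinearMap.congr_fun hr ⟨π M b, b, rfl⟩
        change ev f (r (Ψ ⟨π M b, b, rfl⟩) : B) = _
        rw [← LinearMap.comp_apply, h]
        rfl
      let g : ι → GradedDual π := fun i =>
        hπ.single (M + -j) (G ∘ₗ LinearMap.single K (fun _ => B) i)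
      have hg : ∀ i, g i ∈ P := fun i => ih _ fun k hk b => by
        simp [g, hπ.proj_of_ne (M + -j) k (by omega) b]
      let f₁ : GradedDual π := hπ.single M (ev f)
      have hf₁ : f₁ = ∑ i, (hx i).transpose (g i) := by
        refine GradedDual.ext fun b => ?_
        have h := hG b
        rw [← Finset.univ_sum_single (fun i => x i (π M b)), map_sum] at h
        simp only [map_sum, LinearMap.sum_apply, HasDegree.ev_transpose]
        refine h.symm.trans (Finset.sum_congr rfl fun i _ => ?_)
        simp [g, hx i M b]
      have h₁ : f₁ ∈ P := hf₁ ▸ P.sum_mem fun i _ => hPx i _ (hg i)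
      have h₂ : f - f₁ ∈ P := ih _ fun k hk b => by
        rcases eq_or_lt_of_le hk with rfl | hk'
        · simp [f₁, hπ.proj_self]
        · simp [f₁, hπ.proj_of_ne M k hk'.ne, hf k (by push_cast; omega)]
      simpa using P.add_mem h₂ h₁
  refine eq_top_iff.2 fun f _ => ?_
  obtain ⟨M, hM⟩ := f.exists_ev_proj_eq_zero
  exact key (M - N).toNat f fun k hk => hM k (by omega)

/-- Homogeneous operators that lower degrees and are commutators of operators commuting with
all of them can have a common kernel of bounded degree only on a finite-dimensional space. -/
theorem IsGradedBy.finiteDimensional_of_commutators [IsAlgClosed K] [CharZero K]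
    (hπ : IsGradedBy π s) {ι : Type*} [Fintype ι] {x a b : ι → Module.End K B} {j α β : ℤ}
    (hj : 0 < j) (hx : ∀ i, HasDegree π (x i) (-j)) (ha : ∀ i, HasDegree π (a i) α)
    (hb : ∀ i, HasDegree π (b i) β) (hab : ∀ i, x i = a i * b i - b i * a i)
    (hax : ∀ i l, Commute (a i) (x l)) (hbx : ∀ i l, Commute (b i) (x l)) (N : ℤ)
    (hker : ∀ k, N ≤ k → ∀ b, π k b = b → (∀ i, x i b = 0) → b = 0) :
    FiniteDimensional K B := by
  obtain ⟨F, hF, hFmem⟩ := hπ.fg_lowPart N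
  have : FiniteDimensional K (GradedDual π) := by
    refine GNLA.finiteDimensional_of_commutators (fun i => (hx i).transpose)
      (fun i => (hb i).transpose) (fun i => (ha i).transpose) (fun i => ?_)
      (fun i l => (hb i).commute_transpose (hx l) (hbx i l))
      (fun i l => (ha i).commute_transpose (hx l) (hax i l)) F hF (fun P hP hPx => ?_)
    · refine LinearMap.ext fun f => GradedDual.ext fun c => ?_
      simp [hab]
    · exact hπ.eq_top_of_lowPart_le hj hx N hker P (fun f hf => hP ((hFmem f).2 hf)) hPx
  exact hπ.finiteDimensional_of_gradedDual

/-- A nonzero point in the support of the graded dual is a nonzero formal simultaneous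
eigenvector `∑ k, φ k` of the operators. -/
theorem IsGradedBy.exists_formal_eigenvector [IsAlgClosed K]
    (hπ : IsGradedBy π s) {ι : Type*} [Fintype ι] {x : ι → Module.End K B} {j : ℤ}
    (hj : 0 < j) (hx : ∀ i, HasDegree π (x i) (-j)) (hxx : ∀ i l, Commute (x i) (x l)) (N : ℤ)
    (hker : ∀ k, N ≤ k → ∀ b, π k b = b → (∀ i, x i b = 0) → b = 0)
    (hB : ¬ FiniteDimensional K B) :
    ∃ c : ι → K, c ≠ 0 ∧ ∃ φ : ℤ → B, (∃ k, φ k ≠ 0) ∧ (∀ k, π k (φ k) = φ k) ∧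
      ∀ i k, x i (φ k) = c i • φ (k - j) := by
  obtain ⟨F, hF, hFmem⟩ := hπ.fg_lowPart N
  have hD : ¬ FiniteDimensional K (GradedDual π) := fun h =>
    hB hπ.finiteDimensional_of_gradedDual
  obtain ⟨c, hc, hR⟩ := exists_ne_zero_iSup_range_sub_ne_top (fun i => (hx i).transpose)
    (fun i l => (hx i).commute_transpose (hx l) (hxx i l)) F hF
    (fun P hP hPx => hπ.eq_top_of_lowPart_le hj hx N hker P (fun f hf => hP ((hFmem f).2 hf)) hPx)
    hD
  obtain ⟨E, hE0, hE⟩ := Submodule.exists_le_ker_of_lt_top _ (lt_top_iff_ne_top.2 hR)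
  have hEx : ∀ i f, E ((hx i).transpose f) = c i • E f := fun i f => by
    have h := hE (Submodule.mem_iSup_of_mem i ⟨f, rfl⟩)
    rw [LinearMap.mem_ker] at h
    simpa [sub_eq_zero] using h
  have hfin := hπ.finite_range
  -- By reflexivity, `E` is evaluation at a vector on the dual of each component.
  have hφ : ∀ k, ∃ b, π k b = b ∧
      ∀ g : Module.Dual K B, E (hπ.single k g) = g b := by
    intro k
    let Ek : Module.Dual K (Module.Dual K (LinearMap.range (π k))) :=
      E ∘ₗ LinearMap.codRestrict (gradedDualSubmodule π)
        (Module.Dual.transpose (R := K) (π k).rangeRestrict)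
        (fun h => ⟨k + 1, fun l hl b => by
          have : (π k).rangeRestrict (π l b) = 0 :=
            Subtype.ext (hπ.proj_of_ne k l (by omega) b)
          simp [Module.Dual.transpose_apply, this]⟩)
    let r := (Module.evalEquiv K (LinearMap.range (π k))).symm Ek
    refine ⟨r, ?_, fun g => ?_⟩
    · obtain ⟨b, hb⟩ := r.2
      rw [← hb, hπ.proj_self]
    · have h := Module.apply_evalEquiv_symm_apply K (LinearMap.range (π k))
        (g ∘ₗ (LinearMap.range (π k)).subtype) Ek
      exact h.symm
  choose φ hφπ hφE using hφ
  refine ⟨c, hc, φ, ?_, hφπ, fun i k => ?_⟩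
  · by_contra! h0
    refine hE0 (LinearMap.ext fun f => ?_)
    obtain ⟨M, hM⟩ := f.exists_ev_proj_eq_zero
    have hf : f = ∑ k ∈ Finset.Ico s M, hπ.single k (ev f) := by
      refine GradedDual.ext (LinearMap.congr_fun (hπ.ext_proj fun l hl b => ?_))
      simp only [map_sum, LinearMap.sum_apply, hπ.ev_single]
      by_cases hlM : l < M
      · rw [Finset.sum_eq_single l, hπ.proj_self]
        · exact fun k _ hk => by rw [hπ.proj_of_ne k l hk, map_zero]
        · exact fun h => absurd (Finset.mem_Ico.2 ⟨hl, hlM⟩) h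
      · rw [hM l (by omega), Finset.sum_eq_zero]
        intro k hk
        rw [Finset.mem_Ico] at hk
        rw [hπ.proj_of_ne k l (by omega), map_zero]
    rw [hf, map_sum]
    exact Finset.sum_eq_zero fun k _ => by rw [hφE, h0 k, map_zero]
  · refine sub_eq_zero.1 ((Module.forall_dual_apply_eq_zero_iff K _).1 fun g => ?_)
    have h : hπ.single k (g ∘ₗ x i) = (hx i).transpose (hπ.single (k - j) g) := by
      refine GradedDual.ext fun b => ?_
      rw [HasDegree.ev_transpose, hπ.ev_single, hπ.ev_single, LinearMap.comp_apply, ← hx i k b,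
        sub_eq_add_neg]
    have h2 := hφE k (g ∘ₗ x i)
    rw [h, hEx, hφE] at h2
    rw [map_sub, map_smul, h2, LinearMap.comp_apply, sub_self]

theorem IsGradedBy.restrict (hπ : IsGradedBy π s) (P : Submodule K B)
    (hP : ∀ k, ∀ b ∈ P, π k b ∈ P) : IsGradedBy (fun k => (π k).restrict (hP k)) s where
  finite_range k := by
    have := hπ.finite_range k
    refine FiniteDimensional.of_injective
      (P.subtype.restrict (p := LinearMap.range ((π k).restrict (hP k)))
        (q := LinearMap.range (π k)) ?_) ?_
    · rintro _ ⟨b, rfl⟩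
      exact ⟨b, rfl⟩
    · intro a b h
      have h' := congrArg Subtype.val h
      exact Subtype.ext (Subtype.ext h')
  proj_self k b := Subtype.ext (hπ.proj_self k b)
  proj_of_ne k l hkl b := Subtype.ext (hπ.proj_of_ne k l hkl b)
  sum_proj b := by
    obtain ⟨n, hn⟩ := hπ.sum_proj b
    refine ⟨n, Subtype.ext ?_⟩
    rw [AddSubmonoidClass.coe_finsetSum]
    exact hn

end GradedDual

/-! ### The Tanaka prolongation as a graded module -/

section Prolongation

variable {K : Type u} {L : Type v} [Field K] [LieRing L] [LieAlgebra K L]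
  {ℒ : ℤ → Submodule K L}

open scoped Classical in
/-- The projection of `L` onto its component of degree `k`. -/
noncomputable def IsGNLA.proj (hL : IsGNLA ℒ) (k : ℤ) : Module.End K L :=
  (ℒ k).subtype ∘ₗ DirectSum.component K ℤ (fun k => ℒ k) k ∘ₗ
    (LinearEquiv.ofBijective (DirectSum.coeLinearMap ℒ) hL.isInternal).symm.toLinearMap

theorem IsGNLA.proj_of_mem (hL : IsGNLA ℒ) {j : ℤ} {x : L} (hx : x ∈ ℒ j) (k : ℤ) :
    hL.proj k x = if k = j then x else 0 := by
  classical
  split_ifs with h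
  · subst h
    exact congrArg Subtype.val (hL.isInternal.ofBijective_coeLinearMap_of_mem hx)
  · exact congrArg Subtype.val
      (hL.isInternal.ofBijective_coeLinearMap_of_mem_ne (Ne.symm h) hx)

theorem IsGNLA.proj_mem (hL : IsGNLA ℒ) (k : ℤ) (x : L) : hL.proj k x ∈ ℒ k :=
  Subtype.property _

theorem IsGNLA.exists_eq_bot (hL : IsGNLA ℒ) : ∃ s : ℤ, ∀ i, i < s → ℒ i = ⊥ := by
  have := hL.finiteDimensional
  have hfin : {i | ℒ i ≠ ⊥}.Finite :=
    WellFoundedGT.finite_ne_bot_of_iSupIndep hL.isInternal.submodule_iSupIndep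
  obtain ⟨s, hs⟩ := hfin.bddBelow
  exact ⟨s, fun i hi => by
    by_contra h
    exact absurd (hs h) (by omega)⟩

variable (ℒ) in
/-- The Tanaka prolongation, made a type of its own so that instance search does not unfold it
to spaces of linear maps. -/
def Prolongation : Type v := TanakaProlongation ℒ

namespace Prolongation

instance : AddCommGroup (Prolongation ℒ) := inferInstanceAs (AddCommGroup (TanakaProlongation ℒ))

instance : Module K (Prolongation ℒ) := inferInstanceAs (Module K (TanakaProlongation ℒ))

variable (ℒ) in
/-- The inclusion of `L` in the Tanaka prolongation. -/
noncomputable def ofL : L →ₗ[K] Prolongation ℒ :=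
  LinearMap.inl K L (DirectSum ℕ fun k => tanakaComponent ℒ k)

variable (ℒ) in
/-- The inclusion of the component of degree `k ≥ 0` in the Tanaka prolongation. -/
noncomputable def ofComponent (k : ℕ) : tanakaComponent ℒ k →ₗ[K] Prolongation ℒ :=
  LinearMap.inr K L (DirectSum ℕ fun k => tanakaComponent ℒ k) ∘ₗ
    DirectSum.lof K ℕ (fun k => tanakaComponent ℒ k) k

variable (ℒ) in
/-- The part of negative degree of an element of the Tanaka prolongation. -/
noncomputable def toL : Prolongation ℒ →ₗ[K] L :=
  LinearMap.fst K L (DirectSum ℕ fun k => tanakaComponent ℒ k)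

variable (ℒ) in
/-- The part of degree `k ≥ 0` of an element of the Tanaka prolongation. -/
noncomputable def toComponent (k : ℕ) : Prolongation ℒ →ₗ[K] tanakaComponent ℒ k :=
  DirectSum.component K ℕ (fun k => tanakaComponent ℒ k) k ∘ₗ
    LinearMap.snd K L (DirectSum ℕ fun k => tanakaComponent ℒ k)

@[simp]
theorem toL_ofL (x : L) : toL ℒ (ofL ℒ x) = x := rfl

@[simp]
theorem toL_ofComponent (k : ℕ) (φ : tanakaComponent ℒ k) : toL ℒ (ofComponent ℒ k φ) = 0 := rfl

@[simp]
theorem toComponent_ofL (k : ℕ) (x : L) : toComponent ℒ k (ofL ℒ x) = 0 := rfl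

@[simp]
theorem toComponent_ofComponent_self (k : ℕ) (φ : tanakaComponent ℒ k) :
    toComponent ℒ k (ofComponent ℒ k φ) = φ :=
  DirectSum.component.lof_self (M := fun k => tanakaComponent ℒ k) K k φ

theorem toComponent_ofComponent_of_ne {k l : ℕ} (h : l ≠ k) (φ : tanakaComponent ℒ k) :
    toComponent ℒ l (ofComponent ℒ k φ) = 0 :=
  (DirectSum.component.of (M := fun k => tanakaComponent ℒ k) K l k φ).trans (dif_neg h.symm)

theorem ofComponent_injective (k : ℕ) : Function.Injective (ofComponent ℒ k) :=
  Function.LeftInverse.injective (toComponent_ofComponent_self k)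

variable (ℒ) in
/-- The inclusion of `⨁_{i < k} g_i` in the Tanaka prolongation. -/
noncomputable def ofTruncation : (k : ℕ) → (truncation ℒ k).carrier →ₗ[K] Prolongation ℒ
  | 0 => ofL ℒ
  | k + 1 => (ofTruncation k).coprod (ofComponent ℒ k)

theorem ofTruncation_succ (k : ℕ) (p : (truncation ℒ k).carrier) (φ : tanakaComponent ℒ k) :
    ofTruncation ℒ (k + 1) ((p, φ) : (truncation ℒ k).carrier × tanakaComponent ℒ k) =
      ofTruncation ℒ k p + ofComponent ℒ k φ := rfl

variable (ℒ) in
/-- The linear map on the Tanaka prolongation with given restrictions to the components. -/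
noncomputable def lift {M : Type*} [AddCommGroup M] [Module K M] (f : L →ₗ[K] M)
    (g : ∀ k, tanakaComponent ℒ k →ₗ[K] M) : Prolongation ℒ →ₗ[K] M :=
  LinearMap.coprod f (DirectSum.toModule K ℕ M g)

@[simp]
theorem lift_ofL {M : Type*} [AddCommGroup M] [Module K M] (f : L →ₗ[K] M)
    (g : ∀ k, tanakaComponent ℒ k →ₗ[K] M) (x : L) : lift ℒ f g (ofL ℒ x) = f x := by
  change f x + DirectSum.toModule K ℕ M g 0 = f x
  rw [map_zero, add_zero]

@[simp]
theorem lift_ofComponent {M : Type*} [AddCommGroup M] [Module K M] (f : L →ₗ[K] M)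
    (g : ∀ k, tanakaComponent ℒ k →ₗ[K] M) (k : ℕ) (φ : tanakaComponent ℒ k) :
    lift ℒ f g (ofComponent ℒ k φ) = g k φ := by
  change f 0 + DirectSum.toModule K ℕ M g
    (DirectSum.lof K ℕ (fun k => tanakaComponent ℒ k) k φ) = g k φ
  rw [map_zero, zero_add, DirectSum.toModule_lof]

variable (ℒ) in
/-- The bracket `[p, x]` of `p` in the Tanaka prolongation with `x ∈ L`. -/
noncomputable def br : Prolongation ℒ →ₗ[K] L →ₗ[K] Prolongation ℒ :=
  lift ℒ ((LieAlgebra.ad K L : L →ₗ[K] Module.End K L).compr₂ (ofL ℒ))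
    (fun k => (tanakaComponent ℒ k).subtype.compr₂ (ofTruncation ℒ k))

theorem br_ofL (x z : L) : br ℒ (ofL ℒ x) z = ofL ℒ ⁅x, z⁆ := by
  rw [br, lift_ofL]
  rfl

theorem br_ofComponent (k : ℕ) (φ : tanakaComponent ℒ k) (z : L) :
    br ℒ (ofComponent ℒ k φ) z =
      ofTruncation ℒ k ((φ : L →ₗ[K] (truncation ℒ k).carrier) z) := by
  rw [br, lift_ofComponent]
  rfl

theorem induction {p : Prolongation ℒ → Prop}
    (inl : ∀ x : L, p (ofL ℒ x)) (of : ∀ k φ, p (ofComponent ℒ k φ))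
    (add : ∀ a b, p a → p b → p (a + b)) (a : Prolongation ℒ) : p a := by
  classical
  let inr : (DirectSum ℕ fun k => tanakaComponent ℒ k) →ₗ[K] Prolongation ℒ :=
    LinearMap.inr K L (DirectSum ℕ fun k => tanakaComponent ℒ k)
  have h : a = ofL ℒ a.1 + inr a.2 := Prod.ext (add_zero a.1).symm (zero_add a.2).symm
  rw [h]
  refine add _ _ (inl _) ?_
  generalize a.2 = f
  induction f using DirectSum.induction_on with
  | zero => exact inl 0
  | of k φ => exact of k φ
  | add f g hf hg =>
    rw [map_add]
    exact add _ _ hf hg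

theorem ofTruncation_br (k : ℕ) (p : (truncation ℒ k).carrier) (x : L) :
    ofTruncation ℒ k ((truncation ℒ k).br p x) = br ℒ (ofTruncation ℒ k p) x := by
  induction k with
  | zero => exact (br_ofL (ℒ := ℒ) p x).symm
  | succ k ih =>
    obtain ⟨p, φ⟩ := (p : (truncation ℒ k).carrier × tanakaComponent ℒ k)
    rw [ofTruncation_succ, map_add, LinearMap.add_apply, br_ofComponent, ← ih,
      ← map_add]
    refine (congrArg (ofTruncation ℒ (k + 1)) (Truncation.extend_br _ _ p φ x)).trans ?_
    rw [ofTruncation_succ, map_zero, add_zero]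

/-- The bracket with `L` is a right action. -/
theorem br_lie (a : Prolongation ℒ) (x z : L) :
    br ℒ a ⁅x, z⁆ =
      br ℒ (br ℒ a x) z - br ℒ (br ℒ a z) x := by
  induction a using Prolongation.induction with
  | inl y =>
    rw [br_ofL, br_ofL, br_ofL, br_ofL,
      br_ofL, ← map_sub, leibniz_lie, ← lie_skew ⁅y, z⁆ x, sub_neg_eq_add]
  | of k φ =>
    rw [br_ofComponent, br_ofComponent, br_ofComponent,
      φ.2.2, map_sub, ofTruncation_br, ofTruncation_br]
  | add a b ha hb =>
    simp only [map_add, LinearMap.add_apply, ha, hb]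
    abel

end Prolongation

open Prolongation

/-- The projection of the Tanaka prolongation onto its component of degree `k`. -/
noncomputable def IsGNLA.prolongationProj (hL : IsGNLA ℒ) (k : ℤ) :
    Module.End K (Prolongation ℒ) :=
  ofL ℒ ∘ₗ hL.proj k ∘ₗ toL ℒ +
    if 0 ≤ k then ofComponent ℒ k.toNat ∘ₗ toComponent ℒ k.toNat else 0

theorem IsGNLA.prolongationProj_ofL (hL : IsGNLA ℒ) {j : ℤ} {x : L} (hx : x ∈ ℒ j) (k : ℤ) :
    hL.prolongationProj k (ofL ℒ x) = if k = j then ofL ℒ x else 0 := by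
  simp only [prolongationProj, LinearMap.add_apply, LinearMap.comp_apply, toL_ofL,
    hL.proj_of_mem hx]
  split_ifs <;> simp

theorem IsGNLA.prolongationProj_ofComponent (hL : IsGNLA ℒ) (j : ℕ) (φ : tanakaComponent ℒ j)
    (k : ℤ) : hL.prolongationProj k (ofComponent ℒ j φ) =
      if k = j then ofComponent ℒ j φ else 0 := by
  simp only [prolongationProj, LinearMap.add_apply, LinearMap.comp_apply, toL_ofComponent,
    map_zero, zero_add]
  split_ifs with h1 h2 h2
  · subst h2
    simp
  · simp [toComponent_ofComponent_of_ne (show k.toNat ≠ j by omega)]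
  · omega
  · rfl

theorem IsGNLA.prolongationProj_ofTruncation (hL : IsGNLA ℒ) (m : ℕ) {j : ℤ}
    {p : (truncation ℒ m).carrier} (hp : p ∈ (truncation ℒ m).comp j) (k : ℤ) :
    hL.prolongationProj k (ofTruncation ℒ m p) = if k = j then ofTruncation ℒ m p else 0 := by
  induction m with
  | zero => exact hL.prolongationProj_ofL hp k
  | succ m ih =>
    obtain ⟨p, φ⟩ := (p : (truncation ℒ m).carrier × tanakaComponent ℒ m)
    obtain ⟨hp1, hp2⟩ := hp
    change φ ∈ (if j = m then (⊤ : Submodule K (tanakaComponent ℒ m)) else ⊥) at hp2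
    rw [ofTruncation_succ, map_add, ih hp1, hL.prolongationProj_ofComponent]
    by_cases hj : j = m
    · subst hj
      split_ifs <;> simp
    · rw [if_neg hj, Submodule.mem_bot] at hp2
      subst hp2
      simp

/-- The homogeneous elements span the Tanaka prolongation. -/
theorem IsGNLA.prolongation_induction (hL : IsGNLA ℒ) {p : Prolongation ℒ → Prop}
    (zero : p 0)
    (inl : ∀ j, j < 0 → ∀ x ∈ ℒ j, p (ofL ℒ x)) (of : ∀ k φ, p (ofComponent ℒ k φ))
    (add : ∀ a b, p a → p b → p (a + b)) (a : Prolongation ℒ) : p a := by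
  refine Prolongation.induction (fun x => ?_) of add a
  have hx : x ∈ ⨆ i, ℒ i := hL.isInternal.submodule_iSup_eq_top ▸ trivial
  induction hx using Submodule.iSup_induction' with
  | mem i x hx =>
    rcases lt_or_ge i 0 with hi | hi
    · exact inl i hi x hx
    · rw [hL.eq_bot_of_nonneg i hi, Submodule.mem_bot] at hx
      rw [hx, map_zero]
      exact zero
  | zero => rwa [map_zero]
  | add x z _ _ hx hz =>
    rw [map_add]
    exact add _ _ hx hz

theorem IsGNLA.hasDegree_br (hL : IsGNLA ℒ) {i : ℤ} {x : L} (hx : x ∈ ℒ i) :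
    HasDegree hL.prolongationProj ((br ℒ).flip x) i := by
  intro k a
  simp only [LinearMap.flip_apply]
  induction a using hL.prolongation_induction with
  | zero => simp
  | inl j _ z hz =>
    rw [br_ofL, hL.prolongationProj_ofL (hL.lie_mem hz hx),
      hL.prolongationProj_ofL hz]
    simp only [add_left_inj]
    split_ifs
    · rw [br_ofL]
    · simp
  | of j φ =>
    rw [br_ofComponent, hL.prolongationProj_ofTruncation j (φ.2.1 i x hx),
      hL.prolongationProj_ofComponent]
    simp only [add_left_inj]
    split_ifs
    · rw [br_ofComponent]
    · simp
  | add a b ha hb => simp only [map_add, LinearMap.add_apply, ha, hb]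

theorem finiteDimensional_truncation (hL : IsGNLA ℒ) (k : ℕ) :
    FiniteDimensional K (truncation ℒ k).carrier := by
  have := hL.finiteDimensional
  induction k with
  | zero => exact hL.finiteDimensional
  | succ k ih =>
    exact inferInstanceAs (FiniteDimensional K ((truncation ℒ k).carrier × tanakaComponent ℒ k))

theorem IsGNLA.isGradedBy_prolongationProj (hL : IsGNLA ℒ) {s : ℤ}
    (hs0 : s ≤ 0) (hs : ∀ i, i < s → ℒ i = ⊥) : IsGradedBy hL.prolongationProj s where
  finite_range k := by
    have := hL.finiteDimensional
    have := finiteDimensional_truncation hL k.toNat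
    refine Submodule.finiteDimensional_of_le (S₂ := LinearMap.range (ofL ℒ) ⊔
      LinearMap.range (ofComponent ℒ k.toNat)) ?_
    rintro _ ⟨a, rfl⟩
    induction a using hL.prolongation_induction with
    | zero => simp
    | inl j _ x hx =>
      rw [hL.prolongationProj_ofL hx]
      split_ifs
      · exact Submodule.mem_sup_left ⟨x, rfl⟩
      · exact Submodule.zero_mem _
    | of j φ =>
      rw [hL.prolongationProj_ofComponent]
      split_ifs with h
      · subst h
        exact Submodule.mem_sup_right ⟨φ, rfl⟩
      · exact Submodule.zero_mem _
    | add a b ha hb =>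
      rw [map_add]
      exact Submodule.add_mem _ ha hb
  proj_self k a := by
    induction a using hL.prolongation_induction with
    | zero => simp
    | inl j _ x hx =>
      rw [hL.prolongationProj_ofL hx]
      split_ifs with h
      · rw [hL.prolongationProj_ofL hx, if_pos h]
      · simp
    | of j φ =>
      rw [hL.prolongationProj_ofComponent]
      split_ifs with h
      · rw [hL.prolongationProj_ofComponent, if_pos h]
      · simp
    | add a b ha hb => rw [map_add, map_add, ha, hb]
  proj_of_ne k l hkl a := by
    induction a using hL.prolongation_induction with
    | zero => simp
    | inl j _ x hx =>
      rw [hL.prolongationProj_ofL hx]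
      split_ifs with h
      · rw [hL.prolongationProj_ofL hx, if_neg (h ▸ hkl)]
      · simp
    | of j φ =>
      rw [hL.prolongationProj_ofComponent]
      split_ifs with h
      · rw [hL.prolongationProj_ofComponent, if_neg (h ▸ hkl)]
      · simp
    | add a b ha hb => rw [map_add, map_add, ha, hb, add_zero]
  sum_proj b := by
    suffices h : ∃ n, ∀ m, n ≤ m → ∑ k ∈ Finset.Ico s m, hL.prolongationProj k b = b by
      obtain ⟨n, hn⟩ := h
      exact ⟨n, hn n le_rfl⟩
    induction b using hL.prolongation_induction with
    | zero => exact ⟨0, by simp⟩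
    | inl j _ x hx =>
      simp only [hL.prolongationProj_ofL hx, Finset.sum_ite_eq', Finset.mem_Ico]
      refine ⟨j + 1, fun m hm => ?_⟩
      rcases lt_or_ge j s with hj | hj
      · rw [hs j hj, Submodule.mem_bot] at hx
        simp [hx]
      · rw [if_pos ⟨hj, by omega⟩]
    | of j φ =>
      simp only [hL.prolongationProj_ofComponent, Finset.sum_ite_eq', Finset.mem_Ico]
      exact ⟨j + 1, fun m hm => if_pos ⟨by omega, by omega⟩⟩
    | add a b ha hb =>
      obtain ⟨M, hM⟩ := ha
      obtain ⟨N, hN⟩ := hb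
      refine ⟨max M N, fun m hm => ?_⟩
      simp only [map_add, Finset.sum_add_distrib]
      rw [hM m (le_of_max_le_left hm), hN m (le_of_max_le_right hm)]

theorem Prolongation.toComponent_ofTruncation (k : ℕ) (p : (truncation ℒ k).carrier) (l : ℕ)
    (hl : k ≤ l) : toComponent ℒ l (ofTruncation ℒ k p) = 0 := by
  induction k with
  | zero => rfl
  | succ k ih =>
    obtain ⟨p, φ⟩ := (p : (truncation ℒ k).carrier × tanakaComponent ℒ k)
    rw [ofTruncation_succ, map_add, ih p (by omega), zero_add,
      toComponent_ofComponent_of_ne (by omega)]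

theorem Prolongation.ofTruncation_injective (k : ℕ) :
    Function.Injective (ofTruncation ℒ k) := by
  rw [injective_iff_map_eq_zero]
  induction k with
  | zero => exact fun p hp => congrArg (toL ℒ) hp
  | succ k ih =>
    intro p hp
    obtain ⟨p, φ⟩ := (p : (truncation ℒ k).carrier × tanakaComponent ℒ k)
    rw [ofTruncation_succ] at hp
    have h1 := congrArg (toComponent ℒ k) hp
    rw [map_add, toComponent_ofTruncation k p k le_rfl, zero_add, toComponent_ofComponent_self,
      map_zero] at h1
    subst h1
    rw [map_zero, add_zero] at hp
    rw [ih p hp]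
    rfl

theorem IsGNLA.eq_ofComponent (hL : IsGNLA ℒ) {k : ℕ} {a : Prolongation ℒ}
    (ha : hL.prolongationProj k a = a) : ∃ φ, a = ofComponent ℒ k φ := by
  have h1 := hL.proj_mem k (toL ℒ a)
  rw [hL.eq_bot_of_nonneg k (by omega), Submodule.mem_bot] at h1
  refine ⟨toComponent ℒ k a, ?_⟩
  rw [prolongationProj, if_pos (by omega), LinearMap.add_apply, LinearMap.comp_apply,
    LinearMap.comp_apply, h1, map_zero, zero_add] at ha
  exact ha.symm

/-- An element of non-negative degree that commutes with the component of degree `-1` is zero. -/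
theorem IsGNLA.eq_zero_of_br (hL : IsGNLA ℒ) {k : ℤ} (hk : 0 ≤ k)
    {a : Prolongation ℒ} (ha : hL.prolongationProj k a = a)
    (h : ∀ x ∈ ℒ (-1), br ℒ a x = 0) : a = 0 := by
  lift k to ℕ using hk
  obtain ⟨φ, rfl⟩ := hL.eq_ofComponent ha
  let C : LieSubalgebra K L :=
    { LinearMap.ker (br ℒ (ofComponent ℒ k φ)) with
      lie_mem' := by
        intro x z hx hz
        have hx' : br ℒ (ofComponent ℒ k φ) x = 0 := hx
        have hz' : br ℒ (ofComponent ℒ k φ) z = 0 := hz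
        change br ℒ (ofComponent ℒ k φ) ⁅x, z⁆ = 0
        rw [br_lie, hx', hz', map_zero, LinearMap.zero_apply, LinearMap.zero_apply, sub_zero] }
  have hC : C = ⊤ := by
    rw [eq_top_iff, ← hL.generated, LieSubalgebra.lieSpan_le]
    exact h
  have hφ : φ = 0 := by
    refine Subtype.ext (LinearMap.ext fun x => ofTruncation_injective k ?_)
    have hx : x ∈ C := hC ▸ trivial
    have hx' : br ℒ (ofComponent ℒ k φ) x = 0 := hx
    rw [br_ofComponent] at hx'
    rw [hx']
    simp
  rw [hφ, map_zero]

end Prolongation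

/-! ### Infinite-dimensional prolongations contain a derivation of rank one -/

section InfiniteType

open Prolongation

variable {K : Type u} {L : Type v} [Field K] [LieRing L] [LieAlgebra K L]
  {ℒ : ℤ → Submodule K L}

variable (ℒ) in
/-- The elements of the Tanaka prolongation that commute with all components of degree at
most `-j`. -/
def annihilator (j : ℕ) : Submodule K (Prolongation ℒ) where
  carrier := {a | ∀ i : ℤ, i ≤ -j → ∀ x ∈ ℒ i, br ℒ a x = 0}
  zero_mem' := by simp
  add_mem' := fun {a b} ha hb i hi x hx => by simp [ha i hi x hx, hb i hi x hx]
  smul_mem' := fun c a ha i hi x hx => by simp [ha i hi x hx]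

theorem IsGNLA.proj_mem_annihilator (hL : IsGNLA ℒ) (j : ℕ) (k : ℤ) (a : Prolongation ℒ)
    (ha : a ∈ annihilator ℒ j) : hL.prolongationProj k a ∈ annihilator ℒ j := by
  intro i hi x hx
  have h := hL.hasDegree_br hx k a
  simp only [LinearMap.flip_apply] at h
  rw [← h, ha i hi x hx, map_zero]

theorem IsGNLA.br_mem_annihilator (hL : IsGNLA ℒ) (j : ℕ) {l : ℤ} (hl : l < 0) {z : L}
    (hz : z ∈ ℒ l) (a : Prolongation ℒ) (ha : a ∈ annihilator ℒ j) :
    (br ℒ).flip z a ∈ annihilator ℒ j := by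
  intro i hi x hx
  have h := br_lie a z x
  rw [ha i hi x hx, map_zero, LinearMap.zero_apply, sub_zero,
    ha (l + i) (by omega) _ (hL.lie_mem hz hx)] at h
  exact h.symm

/-- The action of a homogeneous element of `L` on the annihilator. -/
noncomputable def IsGNLA.annihilatorBr (hL : IsGNLA ℒ) (j : ℕ) {l : ℤ} (hl : l < 0) {z : L}
    (hz : z ∈ ℒ l) : Module.End K (annihilator ℒ j) :=
  ((br ℒ).flip z).restrict (hL.br_mem_annihilator j hl hz)

theorem IsGNLA.hasDegree_annihilatorBr (hL : IsGNLA ℒ) (j : ℕ) {l : ℤ} (hl : l < 0) {z : L}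
    (hz : z ∈ ℒ l) :
    HasDegree (fun k => (hL.prolongationProj k).restrict (hL.proj_mem_annihilator j k))
      (hL.annihilatorBr j hl hz) l :=
  fun k b => Subtype.ext (hL.hasDegree_br hz k b)

theorem IsGNLA.commute_annihilatorBr (hL : IsGNLA ℒ) (j : ℕ) {l : ℤ} (hl : l < 0) {z : L}
    (hz : z ∈ ℒ l) {i : ℤ} (hi : i < 0) {x : L} (hx : x ∈ ℒ i) (hil : l + i ≤ -j) :
    Commute (hL.annihilatorBr j hl hz) (hL.annihilatorBr j hi hx) := by
  refine LinearMap.ext fun a => Subtype.ext ?_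
  have h := br_lie (a : Prolongation ℒ) z x
  rw [a.2 _ hil _ (hL.lie_mem hz hx), eq_comm, sub_eq_zero] at h
  exact h.symm

/-- The annihilator has no nonzero elements of large degree. -/
def IsGNLA.AnnihilatorBounded (hL : IsGNLA ℒ) (j : ℕ) : Prop :=
  ∃ N : ℤ, ∀ k, N ≤ k → ∀ a ∈ annihilator ℒ j, hL.prolongationProj k a = a → a = 0

theorem IsGNLA.annihilatorBounded_of_finiteDimensional (hL : IsGNLA ℒ) {s : ℤ}
    (hπ : IsGradedBy hL.prolongationProj s) (j : ℕ) [FiniteDimensional K (annihilator ℒ j)] :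
    hL.AnnihilatorBounded j := by
  obtain ⟨N, hN⟩ :=
    (hπ.restrict _ (hL.proj_mem_annihilator j)).exists_forall_proj_eq_zero
  exact ⟨N, fun k hk a ha hka => hka.symm.trans (congrArg Subtype.val (hN k hk ⟨a, ha⟩))⟩

/-- The component of degree `-j`, `j = n + 2`, consists of sums of commutators and acts centrally
on the annihilator of the lower components, hence `finiteDimensional_of_commutators` applies. -/
theorem IsGNLA.annihilatorBounded_succ [IsAlgClosed K] [CharZero K] (hL : IsGNLA ℒ) {s : ℤ}
    (hπ : IsGradedBy hL.prolongationProj s) (n : ℕ) (h : hL.AnnihilatorBounded (n + 2)) :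
    hL.AnnihilatorBounded (n + 3) := by
  have := hL.finiteDimensional
  have hspan := hL.span_lie_eq n
  have hfg : (Submodule.span K {z | ∃ x ∈ ℒ (-1), ∃ y ∈ ℒ (-(n + 1 : ℤ)), ⁅x, y⁆ = z}).FG :=
    IsNoetherian.noetherian _
  obtain ⟨t, ht, hts⟩ := (Submodule.fg_span_iff_fg_span_finset_subset _).1 hfg
  rw [hspan] at hts
  have hmem : ∀ i : t, (i : L) ∈ ℒ (-((n + 2 : ℕ) : ℤ)) := fun i => by
    have : (i : L) ∈ ℒ (-(n + 2 : ℤ)) := hts ▸ Submodule.subset_span i.2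
    exact_mod_cast this
  choose x hx y hy hxy using fun i : t => ht i.2
  obtain ⟨N, hN⟩ := h
  have hneg : (-((n + 2 : ℕ) : ℤ)) < 0 := by omega
  have hneg' : (-(n + 1 : ℤ)) < 0 := by omega
  have : FiniteDimensional K (annihilator ℒ (n + 3)) := by
    refine (hπ.restrict _ (hL.proj_mem_annihilator (n + 3))).finiteDimensional_of_commutators
      (x := fun i : t => hL.annihilatorBr (n + 3) hneg (hmem i))
      (a := fun i : t => hL.annihilatorBr (n + 3) hneg' (hy i))
      (b := fun i : t => hL.annihilatorBr (n + 3) (by norm_num) (hx i))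
      (j := (n + 2 : ℕ)) (by omega)
      (fun i => hL.hasDegree_annihilatorBr _ _ _)
      (fun i => hL.hasDegree_annihilatorBr _ _ _)
      (fun i => hL.hasDegree_annihilatorBr _ _ _)
      (fun i => LinearMap.ext fun a => Subtype.ext ?_)
      (fun i l => hL.commute_annihilatorBr _ _ _ _ _ (by push_cast; omega))
      (fun i l => hL.commute_annihilatorBr _ _ _ _ _ (by push_cast; omega)) N
      (fun k hk a hka ha => Subtype.ext (hN k hk a ?_ (congrArg Subtype.val hka)))
    · have := br_lie (a : Prolongation ℒ) (x i) (y i)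
      rw [hxy i] at this
      exact this
    · intro i hi z hz
      rcases eq_or_lt_of_le hi with rfl | hi'
      · have hle : ℒ (-((n + 2 : ℕ) : ℤ)) ≤ LinearMap.ker (br ℒ (a : Prolongation ℒ)) := by
          have : (-((n + 2 : ℕ) : ℤ)) = -(n + 2 : ℤ) := by push_cast; rfl
          rw [this, hts, Submodule.span_le]
          exact fun z hz => congrArg Subtype.val (ha ⟨z, hz⟩)
        exact hle hz
      · exact a.2 i (by omega) z hz
  exact hL.annihilatorBounded_of_finiteDimensional hπ (n + 3)

/-- If the prolongation is infinite-dimensional, so is the annihilator of the components of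
degree at most `-2`. -/
theorem IsGNLA.not_finiteDimensional_annihilator_two [IsAlgClosed K] [CharZero K]
    (hL : IsGNLA ℒ) {s : ℤ} (hs : ∀ i, i < s → ℒ i = ⊥)
    (hπ : IsGradedBy hL.prolongationProj s)
    (hinf : ¬ FiniteDimensional K (Prolongation ℒ)) :
    ¬ FiniteDimensional K (annihilator ℒ 2) := by
  intro hfin
  have hall : ∀ n, hL.AnnihilatorBounded (n + 2) := by
    intro n
    induction n with
    | zero => exact hL.annihilatorBounded_of_finiteDimensional hπ 2
    | succ n ih => exact hL.annihilatorBounded_succ hπ n ih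
  obtain ⟨N, hN⟩ := hall s.natAbs
  refine hinf (hπ.finiteDimensional N fun k hk a =>
    hN k hk _ (fun i hi x hx => ?_) (hπ.proj_self k a))
  rw [hs i (by omega), Submodule.mem_bot] at hx
  rw [hx, map_zero]

/-- The part `φ 0` of degree zero of a formal eigenvector in the annihilator is a derivation of
rank one: it maps the component of degree `-1` to the line through `φ (-1)`. -/
theorem IsGNLA.exists_lieDerivation_of_isInfiniteType [IsAlgClosed K] [CharZero K]
    (hL : IsGNLA ℒ) (hinf : IsInfiniteType ℒ) :
    ∃ d : LieDerivation K L L,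
        (∀ i : ℤ, ∀ x ∈ ℒ i, d x ∈ ℒ i) ∧
        (∀ i : ℤ, i ≤ -2 → ∀ x ∈ ℒ i, d x = 0) ∧
        LinearMap.rank (d : L →ₗ[K] L) = 1 := by
  have := hL.finiteDimensional
  have hinf' : ¬ FiniteDimensional K (Prolongation ℒ) := hinf
  obtain ⟨s₀, hs₀⟩ := hL.exists_eq_bot
  have hs : ∀ i, i < min s₀ 0 → ℒ i = ⊥ := fun i hi => hs₀ i (lt_of_lt_of_le hi (min_le_left _ _))
  have hπ := hL.isGradedBy_prolongationProj (min_le_right _ _) hs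
  have hA := hL.not_finiteDimensional_annihilator_two hs hπ hinf'
  obtain ⟨t, ht⟩ : (ℒ (-1)).FG := IsNoetherian.noetherian _
  have hmem : ∀ i : t, (i : L) ∈ ℒ (-1) := fun i => ht ▸ Submodule.subset_span i.2
  -- A vector killed by the finite spanning set `t` is killed by `ℒ (-1)`.
  have hker : ∀ k : ℤ, 0 ≤ k → ∀ b : Prolongation ℒ, hL.prolongationProj k b = b →
      (∀ i : t, br ℒ b i = 0) → b = 0 := fun k hk b hb hbt => by
    refine hL.eq_zero_of_br hk hb fun x hx => ?_
    have hle : ℒ (-1) ≤ LinearMap.ker (br ℒ b) := by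
      rw [← ht, Submodule.span_le]
      exact fun z hz => hbt ⟨z, hz⟩
    exact hle hx
  obtain ⟨c, hc, φ, ⟨m, hm⟩, hφπ, hφ⟩ :=
    (hπ.restrict _ (hL.proj_mem_annihilator 2)).exists_formal_eigenvector
      (x := fun i : t => hL.annihilatorBr 2 (by norm_num) (hmem i)) (j := 1) one_pos
      (fun i => hL.hasDegree_annihilatorBr _ _ _)
      (fun i l => hL.commute_annihilatorBr _ _ _ _ _ (by norm_num)) 0
      (fun k hk b hb hbt => Subtype.ext
        (hker k hk b (congrArg Subtype.val hb) fun i => congrArg Subtype.val (hbt i))) hA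
  have hφ' : ∀ (i : t) k, br ℒ (φ k : Prolongation ℒ) i = c i • (φ (k - 1) : Prolongation ℒ) :=
    fun i k => congrArg Subtype.val (hφ i k)
  obtain ⟨i₀, hi₀⟩ := Function.ne_iff.1 hc
  -- Nonzero terms propagate upwards because `c ≠ 0`, and downwards in non-negative degrees because
  -- these contain no vectors killed by `ℒ (-1)`.
  have hup : ∀ k, φ k ≠ 0 → φ (k + 1) ≠ 0 := fun k hk h0 => by
    have h1 := hφ' i₀ (k + 1)
    rw [h0, add_sub_cancel_right] at h1
    have h2 : c i₀ • (φ k : Prolongation ℒ) = 0 := by rw [← h1]; simp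
    exact hk (Subtype.ext ((smul_eq_zero.1 h2).resolve_left hi₀))
  have hdown : ∀ k, 0 ≤ k → φ k ≠ 0 → φ (k - 1) ≠ 0 := fun k hk hk0 h0 =>
    hk0 (Subtype.ext (hker k hk _ (congrArg Subtype.val (hφπ k)) fun i => by
      rw [hφ', h0]
      simp))
  have hm1 : φ (-1) ≠ 0 := by
    rcases le_total m (-1) with hle | hle
    · exact Int.leInduction (motive := fun k _ => φ k ≠ 0) hm (fun k _ => hup k) (-1) hle
    · have key : ∀ n : ℕ, φ (-1 + n) ≠ 0 → φ (-1) ≠ 0 := by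
        intro n
        induction n with
        | zero => simp
        | succ n ih =>
          intro h
          refine ih ?_
          have := hdown _ (by omega) h
          convert this using 2
          push_cast
          ring
      refine key (m + 1).toNat ?_
      have : (-1 : ℤ) + (m + 1).toNat = m := by omega
      rwa [this]
  obtain ⟨ψ, hψ⟩ : ∃ ψ, (φ 0 : Prolongation ℒ) = ofComponent ℒ 0 ψ :=
    hL.eq_ofComponent (congrArg Subtype.val (hφπ 0))
  let f : L →ₗ[K] L := (ψ : L →ₗ[K] (truncation ℒ 0).carrier)
  have hf : ∀ x, br ℒ (φ 0 : Prolongation ℒ) x = ofL ℒ (f x) := fun x => by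
    rw [hψ, br_ofComponent]
    rfl
  have hofL : Function.Injective (ofL ℒ) := Function.LeftInverse.injective toL_ofL
  let d : LieDerivation K L L :=
    { f with
      leibniz' := fun x z => by
        have h : f ⁅x, z⁆ = ⁅f x, z⁆ - ⁅f z, x⁆ := ψ.2.2 x z
        change f ⁅x, z⁆ = ⁅x, f z⁆ - ⁅z, f x⁆
        rw [h, ← lie_skew, ← lie_skew (f z), sub_neg_eq_add, neg_add_eq_sub] }
  have hd2 : ∀ i : ℤ, i ≤ -2 → ∀ x ∈ ℒ i, f x = 0 := fun i hi x hx => by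
    refine hofL ?_
    rw [← hf, map_zero]
    exact (φ 0).2 i hi x hx
  have hd1 : ofL ℒ (f i₀) = c i₀ • (φ (-1) : Prolongation ℒ) := by
    rw [← hf, hφ']
    rfl
  refine ⟨d, fun i x hx => ?_, hd2, rank_eq_one_of_forall_mem_span (f i₀) (fun x => ?_) ?_⟩
  · have h := ψ.2.1 i x hx
    rw [Nat.cast_zero, zero_add] at h
    exact h
  · have htop : (Submodule.span K {f i₀}).comap f = ⊤ := by
      refine hL.eq_top_of_forall_le _ fun i hi => ?_
      rcases eq_or_ne i (-1) with rfl | hne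
      · rw [← ht, Submodule.span_le]
        intro z hz
        have h : f z = (c ⟨z, hz⟩ * (c i₀)⁻¹) • f i₀ := by
          refine hofL ?_
          rw [map_smul, hd1, smul_smul, mul_assoc, inv_mul_cancel₀ hi₀, mul_one, ← hf]
          exact hφ' ⟨z, hz⟩ 0
        rw [SetLike.mem_coe, Submodule.mem_comap, h]
        exact Submodule.smul_mem _ _ (Submodule.mem_span_singleton_self _)
      · intro z hz
        rw [Submodule.mem_comap, hd2 i (by omega) z hz]
        exact Submodule.zero_mem _
    have hx : x ∈ (Submodule.span K {f i₀}).comap f := htop ▸ trivial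
    exact hx
  · intro h0
    have h1 : f i₀ = 0 := LinearMap.congr_fun h0 i₀
    rw [h1, map_zero] at hd1
    exact hm1 (Subtype.ext ((smul_eq_zero.1 hd1.symm).resolve_left hi₀))

/-- The prolongation is infinite-dimensional as soon as no component vanishes. -/
theorem IsRankOneData.isInfiniteType (hL : IsGNLA ℒ) {y : L} {a : Module.Dual K L} {w : L}
    (h : IsRankOneData ℒ y a w) : IsInfiniteType ℒ := by
  intro hfin
  have hfin' : FiniteDimensional K (Prolongation ℒ) := hfin
  obtain ⟨s₀, hs₀⟩ := hL.exists_eq_bot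
  have hπ := hL.isGradedBy_prolongationProj (min_le_right s₀ 0)
    fun i hi => hs₀ i (lt_of_lt_of_le hi (min_le_left _ _))
  obtain ⟨N, hN⟩ := hπ.exists_forall_proj_eq_zero
  have := h.nontrivial_tanakaComponent hL N.toNat
  obtain ⟨ψ, hψ⟩ := exists_ne (0 : tanakaComponent ℒ N.toNat)
  have h0 := hN N.toNat (by omega) (ofComponent ℒ _ ψ)
  rw [hL.prolongationProj_ofComponent, if_pos rfl] at h0
  exact hψ (ofComponent_injective _ (h0.trans (map_zero _).symm))

end InfiniteType

/-! ### The special extension defined by an element of rank one -/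

section Extension

/-- The action `⁅n, v⁆ = a n • T v` for a fixed endomorphism `T` and a functional `a` that vanishes
on brackets. -/
@[reducible]
def lieRingModuleOfDual {K N V : Type*} [Field K] [LieRing N] [LieAlgebra K N] [AddCommGroup V]
    [Module K V] (a : Module.Dual K N) (T : Module.End K V) (ha : ∀ m n : N, a ⁅m, n⁆ = 0) :
    LieRingModule N V where
  bracket n v := a n • T v
  add_lie m n v := by simp only [map_add, add_smul]
  lie_add n v w := by simp only [map_add, smul_add]
  leibniz_lie m n v := by
    simp only [ha, zero_smul, zero_add, map_smul, smul_smul, mul_comm]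

theorem iSupIndep_comap {ι K V L : Type*} [Field K] [AddCommGroup V] [Module K V]
    [AddCommGroup L] [Module K L] {f : V →ₗ[K] L} (hf : Function.Injective f)
    {P : ι → Submodule K L} (hP : iSupIndep P) : iSupIndep fun i => (P i).comap f := by
  intro i
  refine Submodule.disjoint_def.2 fun v hv hv' => hf ?_
  rw [map_zero]
  refine Submodule.disjoint_def.1 (hP i) (f v) hv ?_
  have hle : (⨆ (j) (_ : j ≠ i), (P j).comap f) ≤ (⨆ (j) (_ : j ≠ i), P j).comap f :=
    iSup₂_le fun j hj => Submodule.comap_mono (le_iSup₂_of_le j hj le_rfl)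
  exact hle hv'

variable {K : Type u} {L : Type v} [Field K] [LieRing L] [LieAlgebra K L]
  {ℒ : ℤ → Submodule K L}

/-- The iterated bracket `[x₀, [x₀, … [x₀, y]]]` with `n` factors `x₀`. -/
def adPow (x₀ y : L) : ℕ → L
  | 0 => y
  | n + 1 => ⁅x₀, adPow x₀ y n⁆

namespace IsRankOneData

variable {y : L} {a : Module.Dual K L} {w x₀ : L}

theorem adPow_mem (hL : IsGNLA ℒ) (h : IsRankOneData ℒ y a w) (hx₀ : x₀ ∈ ℒ (-1)) (n : ℕ) :
    adPow x₀ y n ∈ ℒ (-(n + 1 : ℤ)) := by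
  induction n with
  | zero => simpa [adPow] using h.y_mem
  | succ n ih =>
    have hdeg : (-((n + 1 : ℕ) + 1 : ℤ)) = -1 + -(n + 1 : ℤ) := by
      push_cast
      ring
    rw [hdeg]
    exact hL.lie_mem hx₀ ih

/-- Every `z` acts on the iterated brackets as `a z • ad x₀`; this uses that `a` vanishes on
brackets, so that `[z, x₀]` acts as zero. -/
theorem lie_adPow (hL : IsGNLA ℒ) (h : IsRankOneData ℒ y a w) (ha : a x₀ = 1) (n : ℕ) :
    ∀ z : L, ⁅z, adPow x₀ y n⁆ = a z • adPow x₀ y (n + 1) := by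
  induction n with
  | zero =>
    intro z
    change ⁅z, y⁆ = a z • ⁅x₀, y⁆
    rw [← lie_skew, ← lie_skew x₀, h.lie_eq, h.lie_eq, ha, one_smul, smul_neg]
  | succ n ih =>
    intro z
    change ⁅z, ⁅x₀, adPow x₀ y n⁆⁆ = a z • ⁅x₀, adPow x₀ y (n + 1)⁆
    rw [leibniz_lie, ih ⁅z, x₀⁆, ih z, h.a_lie hL, zero_smul, zero_add, lie_smul]

theorem apply_adPow (hL : IsGNLA ℒ) (hnd : IsNonDegenerate ℒ) (h : IsRankOneData ℒ y a w)
    (hx₀ : x₀ ∈ ℒ (-1)) (n : ℕ) : a (adPow x₀ y n) = 0 := by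
  rcases Nat.eq_zero_or_pos n with rfl | hn
  · have h1 := h.lie_eq y
    rw [lie_self] at h1
    exact (smul_eq_zero.1 h1.symm).resolve_right (h.w_ne hL hnd)
  · exact h.a_eq _ (by omega) _ (h.adPow_mem hL hx₀ n)

theorem adPow_one_ne (hL : IsGNLA ℒ) (hnd : IsNonDegenerate ℒ) (h : IsRankOneData ℒ y a w)
    (ha : a x₀ = 1) : adPow x₀ y 1 ≠ 0 := by
  change ⁅x₀, y⁆ ≠ 0
  rw [← lie_skew, h.lie_eq, ha, one_smul, neg_ne_zero]
  exact h.w_ne hL hnd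

/-- The ideal generated by `y`, spanned by the iterated brackets of `y` with `x₀`. -/
def ideal (hL : IsGNLA ℒ) (h : IsRankOneData ℒ y a w) (ha : a x₀ = 1) : LieIdeal K L where
  __ := Submodule.span K (Set.range (adPow x₀ y))
  lie_mem := by
    intro z v hv
    change v ∈ Submodule.span K (Set.range (adPow x₀ y)) at hv
    change ⁅z, v⁆ ∈ Submodule.span K (Set.range (adPow x₀ y))
    induction hv using Submodule.span_induction with
    | mem _ hv =>
      obtain ⟨n, rfl⟩ := hv
      rw [h.lie_adPow hL ha]
      exact Submodule.smul_mem _ _ (Submodule.subset_span ⟨n + 1, rfl⟩)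
    | zero => simp
    | add v v' _ _ hv hv' =>
      rw [lie_add]
      exact Submodule.add_mem _ hv hv'
    | smul c v _ hv =>
      rw [lie_smul]
      exact Submodule.smul_mem _ _ hv

theorem adPow_mem_ideal (hL : IsGNLA ℒ) (h : IsRankOneData ℒ y a w) (ha : a x₀ = 1) (n : ℕ) :
    adPow x₀ y n ∈ h.ideal hL ha :=
  Submodule.subset_span (Set.mem_range_self (f := adPow x₀ y) n)

theorem ideal_le (hL : IsGNLA ℒ) (h : IsRankOneData ℒ y a w) (ha : a x₀ = 1)
    {P : Submodule K L} (hP : ∀ n, adPow x₀ y n ∈ P) : (h.ideal hL ha).toSubmodule ≤ P :=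
  Submodule.span_le.2 (by
    rintro _ ⟨n, rfl⟩
    exact hP n)

theorem eq_top_of_forall_adPow (hL : IsGNLA ℒ) (h : IsRankOneData ℒ y a w) (ha : a x₀ = 1)
    {P : Submodule K (h.ideal hL ha)}
    (hP : ∀ n, (⟨adPow x₀ y n, h.adPow_mem_ideal hL ha n⟩ : h.ideal hL ha) ∈ P) : P = ⊤ := by
  refine eq_top_iff.2 fun v _ => ?_
  have hle := h.ideal_le hL ha (P := P.map (h.ideal hL ha).toSubmodule.subtype)
    fun n => ⟨_, hP n, rfl⟩
  obtain ⟨v', hv', hvv'⟩ := hle v.2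
  exact (Subtype.ext hvv' : v' = v) ▸ hv'

theorem lie_of_mem_ideal (hL : IsGNLA ℒ) (h : IsRankOneData ℒ y a w) (ha : a x₀ = 1) (z : L)
    {v : L} (hv : v ∈ h.ideal hL ha) : ⁅z, v⁆ = a z • ⁅x₀, v⁆ := by
  have hle := h.ideal_le hL ha
    (P := LinearMap.ker ((LieAlgebra.ad K L z : L →ₗ[K] L) - a z • LieAlgebra.ad K L x₀))
    fun n => by
      rw [LinearMap.mem_ker]
      simp [h.lie_adPow hL ha n, ha]
  have := hle hv
  rw [LinearMap.mem_ker] at this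
  simpa [sub_eq_zero] using this

theorem apply_of_mem_ideal (hL : IsGNLA ℒ) (hnd : IsNonDegenerate ℒ)
    (h : IsRankOneData ℒ y a w) (hx₀ : x₀ ∈ ℒ (-1)) (ha : a x₀ = 1)
    {v : L} (hv : v ∈ h.ideal hL ha) : a v = 0 :=
  h.ideal_le hL ha (P := LinearMap.ker a) (fun n => h.apply_adPow hL hnd hx₀ n) hv

theorem proj_mem_ideal (hL : IsGNLA ℒ) (h : IsRankOneData ℒ y a w) (hx₀ : x₀ ∈ ℒ (-1))
    (ha : a x₀ = 1) (k : ℤ) {v : L} (hv : v ∈ h.ideal hL ha) : hL.proj k v ∈ h.ideal hL ha :=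
  h.ideal_le hL ha (P := (h.ideal hL ha).toSubmodule.comap (hL.proj k)) (fun n => by
    rw [Submodule.mem_comap, hL.proj_of_mem (h.adPow_mem hL hx₀ n)]
    split_ifs
    · exact h.adPow_mem_ideal hL ha n
    · exact Submodule.zero_mem _) hv

theorem mem_span_adPow (hL : IsGNLA ℒ) (h : IsRankOneData ℒ y a w) (hx₀ : x₀ ∈ ℒ (-1))
    (ha : a x₀ = 1) (n : ℕ) {v : L} (hv : v ∈ h.ideal hL ha) (hvn : v ∈ ℒ (-(n + 1 : ℤ))) :
    v ∈ Submodule.span K {adPow x₀ y n} := by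
  have hle := h.ideal_le hL ha
    (P := (Submodule.span K {adPow x₀ y n}).comap (hL.proj (-(n + 1 : ℤ)))) (fun m => by
      rw [Submodule.mem_comap, hL.proj_of_mem (h.adPow_mem hL hx₀ m)]
      split_ifs with hmn
      · have : m = n := by omega
        rw [this]
        exact Submodule.mem_span_singleton_self _
      · exact Submodule.zero_mem _)
  have h1 := hle hv
  rwa [Submodule.mem_comap, hL.proj_of_mem hvn, if_pos rfl] at h1

theorem exists_adPow_eq_zero (hL : IsGNLA ℒ) (hnd : IsNonDegenerate ℒ)
    (h : IsRankOneData ℒ y a w) (hx₀ : x₀ ∈ ℒ (-1)) (ha : a x₀ = 1) :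
    ∃ μ, 2 ≤ μ ∧ (∀ n, n < μ → adPow x₀ y n ≠ 0) ∧ ∀ n, μ ≤ n → adPow x₀ y n = 0 := by
  classical
  have hex : ∃ n, adPow x₀ y n = 0 := by
    obtain ⟨s, hs⟩ := hL.exists_eq_bot
    refine ⟨s.natAbs, ?_⟩
    have h1 := h.adPow_mem hL hx₀ s.natAbs
    rwa [hs _ (by omega), Submodule.mem_bot] at h1
  have hmin : ∀ n, n < Nat.find hex → adPow x₀ y n ≠ 0 := fun n hn => Nat.find_min hex hn
  refine ⟨Nat.find hex, ?_, hmin, fun n hn => ?_⟩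
  · by_contra hlt
    have hspec := Nat.find_spec hex
    have hcases : Nat.find hex = 0 ∨ Nat.find hex = 1 := by omega
    rcases hcases with h0 | h0
    · rw [h0] at hspec
      exact h.y_ne hspec
    · rw [h0] at hspec
      exact h.adPow_one_ne hL hnd ha hspec
  · induction n, hn using Nat.le_induction with
    | base => exact Nat.find_spec hex
    | succ n _ ih =>
      change ⁅x₀, adPow x₀ y n⁆ = 0
      rw [ih, lie_zero]

end IsRankOneData

/-- The quotient of a GNLA by a graded ideal is a GNLA. -/
theorem isGNLA_quotient (hL : IsGNLA ℒ) (I : LieIdeal K L)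
    (hI : ∀ k, ∀ v ∈ I, hL.proj k v ∈ I) :
    IsGNLA fun i => (ℒ i).map (LieSubmodule.Quotient.mk' I : L →ₗ[K] L ⧸ I) where
  finiteDimensional := by
    have := hL.finiteDimensional
    exact Module.Finite.of_surjective (LieSubmodule.Quotient.mk' I : L →ₗ[K] L ⧸ I)
      (LieSubmodule.Quotient.surjective_mk' I)
  isInternal := by
    refine (DirectSum.isInternal_submodule_iff_iSupIndep_and_iSup_eq_top _).2 ⟨fun i => ?_, ?_⟩
    · refine Submodule.disjoint_def.2 ?_
      rintro _ ⟨x, hx, rfl⟩ hr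
      simp only [← Submodule.map_iSup] at hr
      obtain ⟨r, hr, hrx⟩ := hr
      have hr0 : hL.proj i r = 0 := by
        have hle : (⨆ (j) (_ : j ≠ i), ℒ j) ≤ LinearMap.ker (hL.proj i) :=
          iSup₂_le fun j hj z hz => by
            rw [LinearMap.mem_ker, hL.proj_of_mem hz, if_neg hj.symm]
        exact hle hr
      have hxr : x - r ∈ I := by
        rw [← LieSubmodule.Quotient.mk_eq_zero, map_sub, sub_eq_zero]
        exact hrx.symm
      have h1 := hI i _ hxr
      rw [map_sub, hr0, sub_zero, hL.proj_of_mem hx, if_pos rfl] at h1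
      exact (LieSubmodule.Quotient.mk_eq_zero I).2 h1
    · rw [← Submodule.map_iSup, hL.isInternal.submodule_iSup_eq_top, Submodule.map_top,
        LinearMap.range_eq_top]
      exact LieSubmodule.Quotient.surjective_mk' I
  gradedBracket := ⟨by
    rintro i j _ _ ⟨x, hx, rfl⟩ ⟨z, hz, rfl⟩
    exact ⟨⁅x, z⁆, hL.lie_mem hx hz, LieSubmodule.Quotient.mk_bracket I x z⟩⟩
  eq_bot_of_nonneg i hi := by rw [hL.eq_bot_of_nonneg i hi, Submodule.map_bot]
  generated := by
    let π : L →ₗ⁅K⁆ L ⧸ I :=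
      { (LieSubmodule.Quotient.mk' I : L →ₗ[K] L ⧸ I) with
        map_lie' := fun {x z} => LieSubmodule.Quotient.mk_bracket I x z }
    let S := LieSubalgebra.lieSpan K (L ⧸ I)
      ((ℒ (-1)).map (LieSubmodule.Quotient.mk' I : L →ₗ[K] L ⧸ I) : Set (L ⧸ I))
    have hS : S.comap π = ⊤ := by
      rw [eq_top_iff, ← hL.generated, LieSubalgebra.lieSpan_le]
      exact fun x hx => LieSubalgebra.subset_lieSpan ⟨x, hx, rfl⟩
    refine eq_top_iff.2 fun n _ => ?_
    obtain ⟨x, rfl⟩ := LieSubmodule.Quotient.surjective_mk' I n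
    have hx : x ∈ S.comap π := hS ▸ LieSubalgebra.mem_top x
    exact hx

/-- `L` is a special extension of its quotient by the ideal generated by `y`, by means of that
ideal. -/
theorem IsRankOneData.exists_specialExtension (hL : IsGNLA ℒ) (hnd : IsNonDegenerate ℒ)
    {y : L} {a : Module.Dual K L} {w : L} (h : IsRankOneData ℒ y a w) :
    ∃ E : SpecialExtension ℒ,
        Module.finrank K (ℒ (-1)) = Module.finrank K (E.gradN (-1)) + 1 ∧
        2 ≤ E.μ ∧
        ∀ i : ℕ, 1 ≤ i → i ≤ E.μ → Module.finrank K (E.gradV (-(i : ℤ))) = 1 := by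
  have := hL.finiteDimensional
  obtain ⟨x₀, hx₀, ha⟩ := h.exists_eq_one hL
  obtain ⟨μ, hμ, hμne, hμz⟩ := h.exists_adPow_eq_zero hL hnd hx₀ ha
  set I := h.ideal hL ha with hIdef
  let mk : L →ₗ[K] L ⧸ I := LieSubmodule.Quotient.mk' I
  let π : L →ₗ⁅K⁆ L ⧸ I :=
    { mk with map_lie' := fun {x z} => LieSubmodule.Quotient.mk_bracket I x z }
  have hπ : Function.Surjective π := LieSubmodule.Quotient.surjective_mk' I
  have hπ0 : ∀ x, π x = 0 ↔ x ∈ I := fun x => LieSubmodule.Quotient.mk_eq_zero I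
  let abar : Module.Dual K (L ⧸ I) := I.toSubmodule.liftQ a
    fun v hv => h.apply_of_mem_ideal hL hnd hx₀ ha hv
  have habar : ∀ x, abar (π x) = a x := fun x => rfl
  have habar_lie : ∀ m n, abar ⁅m, n⁆ = 0 := fun m n => by
    obtain ⟨x, rfl⟩ := hπ m
    obtain ⟨z, rfl⟩ := hπ n
    rw [← LieHom.map_lie, habar, h.a_lie hL]
  -- `I` is taken as a plain submodule, so that its only bracket is the action of `L ⧸ I`.
  let T : Module.End K I.toSubmodule :=
    (LieAlgebra.ad K L x₀ : L →ₗ[K] L).restrict fun v hv => I.lie_mem hv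
  have hT : ∀ v, (T v : L) = ⁅x₀, (v : L)⁆ := fun _ => rfl
  let instR : LieRingModule (L ⧸ I) I.toSubmodule := lieRingModuleOfDual abar T habar_lie
  have hact : ∀ (n : L ⧸ I) (v : I.toSubmodule), ⁅n, v⁆ = abar n • T v := fun _ _ => rfl
  have hactL : ∀ (x : L) (v : I.toSubmodule), (⁅π x, v⁆ : I.toSubmodule) = ⁅x, (v : L)⁆ :=
    fun x v => (h.lie_of_mem_ideal hL ha x v.2).symm
  let e : ℕ → I.toSubmodule := fun n => ⟨adPow x₀ y n, h.adPow_mem_ideal hL ha n⟩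
  have he : ∀ P : Submodule K I.toSubmodule, (∀ n, e n ∈ P) → P = ⊤ := fun P hP =>
    h.eq_top_of_forall_adPow hL ha hP
  let gradV : ℤ → Submodule K I.toSubmodule := fun i => (ℒ i).comap I.toSubmodule.subtype
  have heV : ∀ n : ℕ, e n ∈ gradV (-(n + 1 : ℤ)) := fun n => h.adPow_mem hL hx₀ n
  have hspan : ∀ (n : ℕ) (v : I.toSubmodule), v ∈ gradV (-(n + 1 : ℤ)) →
      ∃ c : K, c • e n = v := fun n v hv => by
    obtain ⟨c, hc⟩ := Submodule.mem_span_singleton.1 (h.mem_span_adPow hL hx₀ ha n v.2 hv)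
    exact ⟨c, Subtype.ext hc⟩
  let E : SpecialExtension ℒ :=
    { N := L ⧸ I
      gradN := fun i => (ℒ i).map mk
      isGNLA := isGNLA_quotient hL I fun k v hv => h.proj_mem_ideal hL hx₀ ha k hv
      W := (ℒ (-1) ⊓ LinearMap.ker a).map mk
      W_le := Submodule.map_mono inf_le_left
      V := I.toSubmodule
      lieModuleV :=
        { smul_lie := fun c n v => by rw [hact, hact, map_smul, smul_assoc]
          lie_smul := fun c n v => by rw [hact, hact, map_smul, smul_comm] }
      gradV := gradV
      isInternal_V := by
        refine (DirectSum.isInternal_submodule_iff_iSupIndep_and_iSup_eq_top _).2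
          ⟨iSupIndep_comap I.toSubmodule.injective_subtype hL.isInternal.submodule_iSupIndep,
            he _ fun n => Submodule.mem_iSup_of_mem _ (heV n)⟩
      μ := μ
      gradV_eq_bot := fun i hi => by
        refine (Submodule.eq_bot_iff _).2 fun v hv => ?_
        rcases lt_or_ge i 0 with hi0 | hi0
        · obtain ⟨n, rfl⟩ : ∃ n : ℕ, i = -(n + 1 : ℤ) := ⟨(-i - 1).toNat, by omega⟩
          obtain ⟨c, rfl⟩ := hspan n v hv
          have : e n = 0 := Subtype.ext (hμz n (by omega))
          rw [this, smul_zero]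
        · have hv' : (v : L) ∈ ℒ i := hv
          rw [hL.eq_bot_of_nonneg i hi0, Submodule.mem_bot] at hv'
          exact Subtype.ext hv'
      lie_mem := by
        rintro i j _ ⟨x, hx, rfl⟩ v hv
        change (⁅π x, v⁆ : I.toSubmodule).1 ∈ ℒ (i + j)
        rw [hactL]
        exact hL.lie_mem hx hv
      lie_W := by
        rintro _ ⟨x, ⟨-, hx⟩, rfl⟩ v
        have hx' : abar (mk x) = 0 := hx
        rw [hact, hx', zero_smul]
      lie_of_le_neg_two := by
        rintro i hi _ ⟨x, hx, rfl⟩ v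
        have hx' : abar (mk x) = 0 := h.a_eq i hi x hx
        rw [hact, hx', zero_smul]
      generated_V := by
        have hgen : ∀ n, e n ∈ LieSubmodule.lieSpan K (L ⧸ I) (gradV (-1) : Set I.toSubmodule) := by
          intro n
          induction n with
          | zero => exact LieSubmodule.subset_lieSpan (heV 0)
          | succ n ih =>
            have h1 : e (n + 1) = ⁅π x₀, e n⁆ := Subtype.ext (hactL x₀ (e n)).symm
            rw [h1]
            exact LieSubmodule.lie_mem _ ih
        exact (LieSubmodule.toSubmodule_eq_top _).1 (he _ hgen)
      incl := I.toSubmodule.subtype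
      proj := π
      incl_injective := I.toSubmodule.injective_subtype
      exact := fun x => by
        rw [hπ0]
        exact ⟨fun hx => ⟨⟨x, hx⟩, rfl⟩, by
          rintro ⟨v, rfl⟩
          exact v.2⟩
      proj_surjective := hπ
      incl_lie_incl := fun v v' => by
        change ⁅(v : L), (v' : L)⁆ = 0
        rw [h.lie_of_mem_ideal hL ha v v'.2, h.apply_of_mem_ideal hL hnd hx₀ ha v.2, zero_smul]
      lie_incl := fun x v => (hactL x v).symm
      incl_mem := fun i v hv => hv
      proj_mem := fun i x hx => ⟨x, hx, rfl⟩ }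
  refine ⟨E, ?_, hμ, fun i hi hiμ => ?_⟩
  · let f := mk.domRestrict (ℒ (-1))
    have hker : Module.finrank K (LinearMap.ker f) = 1 := by
      refine finrank_eq_one_iff'.2
        ⟨⟨⟨y, h.y_mem⟩, (hπ0 y).2 (h.adPow_mem_ideal hL ha 0)⟩, ?_, ?_⟩
      · exact fun h0 => h.y_ne (congrArg Subtype.val (congrArg Subtype.val h0))
      · rintro ⟨⟨z, hz⟩, hzI⟩
        obtain ⟨c, hc⟩ := hspan 0 ⟨z, (hπ0 z).1 hzI⟩ (by simpa [gradV] using hz)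
        have hc' : c • y = z := congrArg Subtype.val hc
        exact ⟨c, Subtype.ext (Subtype.ext hc')⟩
    have hrange : LinearMap.range f = (ℒ (-1)).map mk := LinearMap.range_domRestrict _ _
    have hsum := LinearMap.finrank_range_add_finrank_ker f
    rw [hker, hrange] at hsum
    exact hsum.symm
  · obtain ⟨n, rfl⟩ : ∃ n, i = n + 1 := ⟨i - 1, by omega⟩
    have hdeg : (-((n + 1 : ℕ) : ℤ)) = -(n + 1 : ℤ) := by push_cast; rfl
    rw [hdeg]
    refine finrank_eq_one_iff'.2 ⟨⟨e n, heV n⟩, ?_, ?_⟩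
    · exact fun h0 => hμne n (Nat.lt_of_succ_le hiμ)
        (congrArg Subtype.val (congrArg Subtype.val h0))
    · rintro ⟨v, hv⟩
      obtain ⟨c, hc⟩ := hspan n v hv
      exact ⟨c, Subtype.ext hc⟩

end Extension

end GNLA

theorem theorem1 {K : Type u} {L : Type v} [Field K] [IsAlgClosed K] [CharZero K]
    [LieRing L] [LieAlgebra K L] (ℒ : ℤ → Submodule K L)
    (hL : GNLA.IsGNLA ℒ) (hnd : GNLA.IsNonDegenerate ℒ) :
    List.TFAE [
      ∃ d : LieDerivation K L L,
        (∀ i : ℤ, ∀ x ∈ ℒ i, d x ∈ ℒ i) ∧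
        (∀ i : ℤ, i ≤ -2 → ∀ x ∈ ℒ i, d x = 0) ∧
        LinearMap.rank (d : L →ₗ[K] L) = 1,
      ∃ y ∈ ℒ (-1), LinearMap.rank (LieAlgebra.ad K L y) = 1,
      ∃ E : GNLA.SpecialExtension ℒ,
        Module.finrank K (ℒ (-1)) = Module.finrank K (E.gradN (-1)) + 1 ∧
        2 ≤ E.μ ∧
        ∀ i : ℕ, 1 ≤ i → i ≤ E.μ → Module.finrank K (E.gradV (-(i : ℤ))) = 1,
      GNLA.IsInfiniteType ℒ] ∧
    ∀ y ∈ ℒ (-1), LinearMap.rank (LieAlgebra.ad K L y) = 1 →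
      ∀ i : ℤ, i ≤ -2 → ∀ x ∈ ℒ i, ⁅y, x⁆ = 0 := by
  refine ⟨?_, fun y hy hr i hi x hx => ?_⟩
  · tfae_have 1 → 2 := by
      rintro ⟨d, hd0, hd2, hr⟩
      obtain ⟨y, a, w, h⟩ := GNLA.exists_isRankOneData_of_lieDerivation hL d hd0 hd2 hr
      exact ⟨y, h.y_mem, h.rank_ad hL hnd⟩
    tfae_have 2 → 1 := by
      rintro ⟨y, hy, hr⟩
      obtain ⟨a, w, h⟩ := GNLA.exists_isRankOneData_of_rank_ad hL hnd hy hr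
      exact h.exists_lieDerivation hL
    tfae_have 2 → 3 := by
      rintro ⟨y, hy, hr⟩
      obtain ⟨a, w, h⟩ := GNLA.exists_isRankOneData_of_rank_ad hL hnd hy hr
      exact h.exists_specialExtension hL hnd
    tfae_have 3 → 2 := by
      rintro ⟨E, -, hμ, hdim⟩
      exact E.exists_rank_ad hL hnd hμ hdim
    tfae_have 2 → 4 := by
      rintro ⟨y, hy, hr⟩
      obtain ⟨a, w, h⟩ := GNLA.exists_isRankOneData_of_rank_ad hL hnd hy hr
      exact h.isInfiniteType hL
    tfae_have 4 → 1 := fun hinf => hL.exists_lieDerivation_of_isInfiniteType hinf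
    tfae_finish
  · obtain ⟨a, w, h⟩ := GNLA.exists_isRankOneData_of_rank_ad hL hnd hy hr
    rw [h.lie_eq, h.a_eq i hi x hx, zero_smul]
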